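/- Let $\Lambda$ be an Artin algebra (an algebra over a commutative Artinian ring $R$, finitely generated as an $R$-module) and let $n\ge 0$ be an integer such that $\Lambda$ is $n$-Gorenstein, i.e. $\operatorname{id}({}_\Lambda\Lambda)\le n$ and $\operatorname{id}(\Lambda_\Lambda)\le n$. Let $\operatorname{mod}\Lambda$ be the category of finitely generated left $\Lambda$-modules, and let $\operatorname{DMor}(\operatorname{mod}\Lambda)$ be the category whose objects are tuples $(X,Y,f,g)$ with $f\colon X\to Y$ and $g\colon Y\to X$ in $\operatorname{mod}\Lambda$ such that both composites of $f$ and $g$ are zero, and whose morphisms are pairs of maps $X\to X'$, $Y\to Y'$ commuting with the structure maps. Let $\operatorname{mono}(\Lambda)$ be its full subcategory of objects $(X,Y,f,0)$ with $f$ a monomorphism, with conflations the (componentwise) short exact sequences of $\operatorname{DMor}(\operatorname{mod}\Lambda)$ whose terms lie in $\operatorname{mono}(\Lambda)$, and let $$\mathscr C=\{(X,Y,f,0)\in\operatorname{mono}(\Lambda)\mid \operatorname{pd}_\Lambda X<\infty\}.$$ Then $\mathscr C$ is an $n$-Gorenstein subcategory of the exact category $\operatorname{mono}(\Lambda)$.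 Explicitly: $\operatorname{mono}(\Lambda)$ is an exact category (in the sense of Quillen) with enough projective objects; $\mathscr C$ is an exact subcategory, i.e. it contains the zero objects and is closed under isomorphisms, direct summands and extensions; and for every object $C$ of $\mathscr C$ there is an exact sequence $$0\to G_n\to\cdots\to G_1\to G_0\to C\to 0$$ in the exact category $\mathscr C$ in which every $G_j$ ($0\le j\le n$) is a Gorenstein-projective object of $\operatorname{mono}(\Lambda)$. Here the conflations of $\mathscr C$ are the conflations of $\operatorname{mono}(\Lambda)$ with all terms in $\mathscr C$. A complex $K^\bullet$ in an exact category is acyclic (an exact sequence) if there are objects $Z^i$ and conflations $Z^i\to K^i\to Z^{i+1}$ of that category such that each differential $K^i\to K^{i+1}$ is the composite $K^i\to Z^{i+1}\to K^{i+1}$. An object $P$ is projective if $\operatorname{Hom}(P,-)$ sends conflations to short exact sequences. An object $G$ of an exact category $\mathscr A$ is Gorenstein-projective if there is an acyclic complex $P^\bullet$ of projective objects (indexed by $\mathbb Z$) such that $\operatorname{Hom}_{\mathscr A}(P^\bullet,P)$ is acyclic for every projective object $P$ and the differential $P^0\to P^1$ is the composite of a deflation $P^0\to G$ and an inflation $G\to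 P^1$, inflations and deflations being the first and second maps of conflations. -/

import Mathlib

open CategoryTheory CategoryTheory.Limits

namespace MonoGorenstein

universe v u w

/-! ### Exact categories -/

section ExactCategories

variable {C : Type u} [Category.{v} C] [Preadditive C]

/-- A composable pair `X ⟶ Y ⟶ Z` is exact if the first map is a kernel of the second and the
second is a cokernel of the first. -/
def IsExactPair (S : ShortComplex C) : Prop :=
  Nonempty (IsLimit (KernelFork.ofι S.f S.zero)) ∧
    Nonempty (IsColimit (CokernelCofork.ofπ S.g S.zero))

/-- The first maps of the conflations in `E`. -/
def IsInflation (E : ObjectProperty (ShortComplex C)) {X Y : C} (f : X ⟶ Y) : Prop :=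
  ∃ (Z : C) (g : Y ⟶ Z) (h : f ≫ g = 0), E (ShortComplex.mk f g h)

/-- The second maps of the conflations in `E`. -/
def IsDeflation (E : ObjectProperty (ShortComplex C)) {Y Z : C} (g : Y ⟶ Z) : Prop :=
  ∃ (X : C) (f : X ⟶ Y) (h : f ≫ g = 0), E (ShortComplex.mk f g h)

/-- `(C, E)` is an exact category: `C` is additive and `E` is a class of exact pairs (the
conflations), closed under isomorphisms, that satisfies the axioms of Quillen and Keller. -/
structure IsExactCategory (E : ObjectProperty (ShortComplex C)) : Prop where
  hasFiniteBiproducts : HasFiniteBiproducts C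
  isExactPair : ∀ S : ShortComplex C, E S → IsExactPair S
  closedUnderIso : ∀ S T : ShortComplex C, Nonempty (S ≅ T) → E S → E T
  id_zero : ∀ Z : C, IsZero Z → IsDeflation E (𝟙 Z)
  comp_deflation : ∀ {X Y Z : C} (f : X ⟶ Y) (g : Y ⟶ Z),
    IsDeflation E f → IsDeflation E g → IsDeflation E (f ≫ g)
  pullback_deflation : ∀ {Y Z Z' : C} (g : Y ⟶ Z) (c : Z' ⟶ Z), IsDeflation E g →
    ∃ (Y' : C) (c' : Y' ⟶ Y) (g' : Y' ⟶ Z'), IsPullback c' g' g c ∧ IsDeflation E g'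
  pushout_inflation : ∀ {X Y X' : C} (f : X ⟶ Y) (a : X ⟶ X'), IsInflation E f →
    ∃ (Y' : C) (a' : Y ⟶ Y') (f' : X' ⟶ Y'), IsPushout f a a' f' ∧ IsInflation E f'

/-- `P` is projective in `(C, E)`: `Hom(P, -)` sends conflations to short exact sequences.
As the first map of a conflation is a kernel of the second, this means that `Hom(P, -)` sends
deflations to surjections. -/
def IsProjectiveObj (E : ObjectProperty (ShortComplex C)) (P : C) : Prop :=
  ∀ S : ShortComplex C, E S → Function.Surjective (fun a : P ⟶ S.X₂ => a ≫ S.g)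

/-- `(C, E)` has enough projectives. -/
def HasEnoughProjectives (E : ObjectProperty (ShortComplex C)) : Prop :=
  ∀ X : C, ∃ (P : C) (g : P ⟶ X), IsProjectiveObj E P ∧ IsDeflation E g

/-- A complex is acyclic in `(C, E)` if each differential `K.X i ⟶ K.X (i + 1)` factors as
`K.X i ⟶ Z (i + 1) ⟶ K.X (i + 1)` in such a way that all pairs
`Z i ⟶ K.X i ⟶ Z (i + 1)` are conflations. -/
def IsAcyclic (E : ObjectProperty (ShortComplex C)) (K : CochainComplex C ℤ) : Prop :=
  ∃ (Z : ℤ → C) (ι : ∀ i, Z i ⟶ K.X i) (π : ∀ i, K.X i ⟶ Z (i + 1)) (h : ∀ i, ι i ≫ π i = 0),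
    (∀ i, E (ShortComplex.mk (ι i) (π i) (h i))) ∧ ∀ i, K.d i (i + 1) = π i ≫ ι (i + 1)

/-- `X` is Gorenstein-projective in `(C, E)`: there is an acyclic complex `K` of projectives such
that `Hom(K, P)` is acyclic for every projective `P`, and the differential `K.X 0 ⟶ K.X 1` is the
composite of a deflation `K.X 0 ⟶ X` and an inflation `X ⟶ K.X 1`. -/
def IsGorensteinProjective (E : ObjectProperty (ShortComplex C)) (X : C) : Prop :=
  ∃ K : CochainComplex C ℤ,
    (∀ i, IsProjectiveObj E (K.X i)) ∧
    IsAcyclic E K ∧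
    (∀ P : C, IsProjectiveObj E P → ∀ i : ℤ,
      Function.Exact (fun a : K.X (i + 1 + 1) ⟶ P => K.d (i + 1) (i + 1 + 1) ≫ a)
        (fun a : K.X (i + 1) ⟶ P => K.d i (i + 1) ≫ a)) ∧
    ∃ (κ : K.X 0 ⟶ X) (l : X ⟶ K.X 1), IsDeflation E κ ∧ IsInflation E l ∧ K.d 0 1 = κ ≫ l

/-- The full subcategory `B` is an exact subcategory of `(C, E)`: it is closed under isomorphisms
and direct summands (as all subcategories are), contains the zero objects and is closed under
extensions. -/
structure IsExactSubcategory (E : ObjectProperty (ShortComplex C)) (B : ObjectProperty C) :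
    Prop where
  closedUnderIso : ∀ X Y : C, Nonempty (X ≅ Y) → B X → B Y
  closedUnderSummands : ∀ X Y : C, Nonempty (Retract X Y) → B Y → B X
  zero_mem : ∀ Z : C, IsZero Z → B Z
  extensionClosed : ∀ S : ShortComplex C, E S → B S.X₁ → B S.X₃ → B S.X₂

/-- The conflations of an exact subcategory: the conflations of `(C, E)` with all three terms
in `B`. -/
def inducedConflations (E : ObjectProperty (ShortComplex C)) (B : ObjectProperty C) :
    ObjectProperty (ShortComplex B.FullSubcategory) :=
  fun S => E (S.map B.ι)

/-- There is an exact sequence `0 ⟶ G n ⟶ ⋯ ⟶ G 0 ⟶ X ⟶ 0` in the exact category `B` with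
all `G j` Gorenstein-projective in `(C, E)`. It is written as an acyclic complex over `B`
with `X` in degree `0`, `G j` in degree `-(j + 1)` and zero in all other degrees. -/
def HasGorensteinProjectiveResolution (E : ObjectProperty (ShortComplex C)) (B : ObjectProperty C)
    (n : ℕ) (X : B.FullSubcategory) : Prop :=
  ∃ K : CochainComplex B.FullSubcategory ℤ,
    IsAcyclic (inducedConflations E B) K ∧
    Nonempty (K.X 0 ≅ X) ∧
    (∀ j : ℕ, j ≤ n → IsGorensteinProjective E (K.X (-((j : ℤ) + 1))).obj) ∧
    ∀ i : ℤ, (0 < i ∨ i < -((n : ℤ) + 1)) → IsZero (K.X i)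

/-- `B` is an `n`-Gorenstein subcategory of the exact category `(C, E)` with enough
projectives. -/
structure IsGorensteinSubcategory (E : ObjectProperty (ShortComplex C)) (B : ObjectProperty C)
    (n : ℕ) : Prop where
  isExactCategory : IsExactCategory E
  hasEnoughProjectives : HasEnoughProjectives E
  isExactSubcategory : IsExactSubcategory E B
  resolution : ∀ X : B.FullSubcategory, HasGorensteinProjectiveResolution E B n X

end ExactCategories

/-! ### The double morphism category -/

section DoubleMorphisms

/-- Objects of the double morphism category: pairs of maps `f : X ⟶ Y`, `g : Y ⟶ X` with both
composites zero. -/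
structure DMor (A : Type u) [Category.{v} A] [Preadditive A] where
  X : A
  Y : A
  f : X ⟶ Y
  g : Y ⟶ X
  f_comp_g : f ≫ g = 0
  g_comp_f : g ≫ f = 0

variable {A : Type u} [Category.{v} A] [Preadditive A]

namespace DMor

/-- Morphisms of the double morphism category. -/
@[ext]
structure Hom (M N : DMor A) where
  a : M.X ⟶ N.X
  b : M.Y ⟶ N.Y
  comm_f : M.f ≫ b = a ≫ N.f
  comm_g : M.g ≫ a = b ≫ N.g

instance : Category (DMor A) where
  Hom M N := Hom M N
  id M := ⟨𝟙 _, 𝟙 _, by simp, by simp⟩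
  comp u w := ⟨u.a ≫ w.a, u.b ≫ w.b,
    by rw [← Category.assoc, u.comm_f, Category.assoc, w.comm_f, Category.assoc],
    by rw [← Category.assoc, u.comm_g, Category.assoc, w.comm_g, Category.assoc]⟩
  id_comp u := by apply Hom.ext <;> simp
  comp_id u := by apply Hom.ext <;> simp
  assoc u w x := by apply Hom.ext <;> simp

@[ext]
theorem hom_ext {M N : DMor A} {u w : M ⟶ N} (ha : u.a = w.a) (hb : u.b = w.b) : u = w :=
  Hom.ext ha hb

@[simp] theorem id_a (M : DMor A) : Hom.a (𝟙 M) = 𝟙 M.X := rfl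
@[simp] theorem id_b (M : DMor A) : Hom.b (𝟙 M) = 𝟙 M.Y := rfl
@[simp] theorem comp_a {M N K : DMor A} (u : M ⟶ N) (w : N ⟶ K) : (u ≫ w).a = u.a ≫ w.a := rfl
@[simp] theorem comp_b {M N K : DMor A} (u : M ⟶ N) (w : N ⟶ K) : (u ≫ w).b = u.b ≫ w.b := rfl

section

variable {M N : DMor A}

instance : Zero (M ⟶ N) := ⟨⟨0, 0, by simp, by simp⟩⟩
instance : Add (M ⟶ N) :=
  ⟨fun u w => ⟨u.a + w.a, u.b + w.b, by simp [u.comm_f, w.comm_f], by simp [u.comm_g, w.comm_g]⟩⟩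
instance : Neg (M ⟶ N) := ⟨fun u => ⟨-u.a, -u.b, by simp [u.comm_f], by simp [u.comm_g]⟩⟩
instance : Sub (M ⟶ N) :=
  ⟨fun u w => ⟨u.a - w.a, u.b - w.b, by simp [u.comm_f, w.comm_f], by simp [u.comm_g, w.comm_g]⟩⟩
instance : SMul ℕ (M ⟶ N) :=
  ⟨fun k u => ⟨k • u.a, k • u.b, by simp [u.comm_f], by simp [u.comm_g]⟩⟩
instance : SMul ℤ (M ⟶ N) :=
  ⟨fun k u => ⟨k • u.a, k • u.b, by simp [u.comm_f], by simp [u.comm_g]⟩⟩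

@[simp] theorem zero_a : Hom.a (0 : M ⟶ N) = 0 := rfl
@[simp] theorem zero_b : Hom.b (0 : M ⟶ N) = 0 := rfl
@[simp] theorem add_a (u w : M ⟶ N) : Hom.a (u + w) = u.a + w.a := rfl
@[simp] theorem add_b (u w : M ⟶ N) : Hom.b (u + w) = u.b + w.b := rfl

theorem toProd_injective :
    Function.Injective (fun u : M ⟶ N => ((u.a, u.b) : (M.X ⟶ N.X) × (M.Y ⟶ N.Y))) := by
  intro u w h
  exact hom_ext (congrArg Prod.fst h) (congrArg Prod.snd h)

instance : AddCommGroup (M ⟶ N) :=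
  toProd_injective.addCommGroup _ rfl (fun _ _ => rfl) (fun _ => rfl) (fun _ _ => rfl)
    (fun _ _ => rfl) (fun _ _ => rfl)

end

instance : Preadditive (DMor A) where
  add_comp _ _ _ _ _ _ := by apply hom_ext <;> simp
  comp_add _ _ _ _ _ _ := by apply hom_ext <;> simp

/-- The functor `(X, Y, f, g) ↦ X`. -/
def U₁ : DMor A ⥤ A where
  obj M := M.X
  map u := u.a

/-- The functor `(X, Y, f, g) ↦ Y`. -/
def U₂ : DMor A ⥤ A where
  obj M := M.Y
  map u := u.b

instance : (U₁ (A := A)).Additive where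
  map_add := rfl

instance : (U₂ (A := A)).Additive where
  map_add := rfl

/-- Short exact sequences in the double morphism category of an abelian category, where kernels
and cokernels are formed componentwise. -/
def IsShortExact (S : ShortComplex (DMor A)) : Prop :=
  (S.map U₁).ShortExact ∧ (S.map U₂).ShortExact

end DMor

/-! ### The monomorphism category -/

/-- The objects `(X, Y, f, 0)` with `f` a monomorphism. -/
def isMono (A : Type u) [Category.{v} A] [Preadditive A] : ObjectProperty (DMor A) :=
  fun M => Mono M.f ∧ M.g = 0

/-- The monomorphism category of an abelian category, as a full subcategory of the double morphism
category. -/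
abbrev MonoCat (A : Type u) [Category.{v} A] [Preadditive A] := (isMono A).FullSubcategory

/-- The conflations of the monomorphism category: the short exact sequences of the double morphism
category with all terms in the monomorphism category. -/
def monoConflations (A : Type u) [Category.{v} A] [Preadditive A] :
    ObjectProperty (ShortComplex (MonoCat A)) :=
  fun S => DMor.IsShortExact (S.map (isMono A).ι)

end DoubleMorphisms

/-! ### Artin algebras -/

section Algebras

/-- `L` is an Artin algebra: an algebra over a commutative Artinian ring that is finitely generated
as a module. -/
def IsArtinAlgebra (R : Type w) (L : Type u) [CommRing R] [Ring L] [Algebra R L] : Prop :=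
  IsArtinianRing R ∧ Module.Finite R L

/-- `L` has injective dimension at most `n` as a left and as a right module over itself. -/
def IsGorensteinRing (n : ℕ) (L : Type u) [Ring L] : Prop :=
  injectiveDimension (ModuleCat.of.{u} L L) ≤ n ∧
    injectiveDimension (ModuleCat.of.{u} Lᵐᵒᵖ L) ≤ n

/-- The monomorphism category of the finitely generated left `L`-modules. -/
abbrev mono (L : Type u) [Ring L] := MonoCat (FGModuleCat.{u} L)

/-- The objects `(X, Y, f, 0)` of `mono L` for which `X` has finite projective dimension over
`L`. -/
def finiteProjDim (L : Type u) [Ring L] : ObjectProperty (mono L) :=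
  fun M => projectiveDimension (C := ModuleCat.{u} L) M.obj.X.obj < ⊤

end Algebras

end MonoGorenstein

/-!
Write `V*` for `Hom_L(V, L)` and call a finitely generated module `V` *orthogonal* if
`Ext^i(V, L) = 0` for all `i > 0`.

**Modules.** Over an `n`-Gorenstein Artin algebra an orthogonal module `V` embeds into a free module
with orthogonal cokernel. The components of the embedding are generators of `V*`, so that every map
`V ⟶ L` extends along it; this gives the vanishing for the cokernel (`IsSES.extVanish_right`). That
it is injective means that `V` is torsionless (`eq_zero_of_forall_dual_eq_zero`). Here the injective
dimension of `L` on the right enters: the dual of a sequence `0 ⟶ K ⟶ P ⟶ V ⟶ 0` with `P` free and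
`V` orthogonal is a short exact sequence of right modules and `K` is again orthogonal, so the duals
of orthogonal modules are syzygies of arbitrarily high order and have no higher extensions by `L`
(`extVanish_dual`); hence dualizing a free presentation of `V` twice gives it back.

**Monomorphisms.** An object `f : X ⟶ Y` of `mono L` with cokernel `V` lies in `extBounded k` if `X`
has finite projective dimension and `Ext^i(X, L) = Ext^i(V, L) = 0` for all `i > k`. For `k = n`
these are exactly the objects with `X` of finite projective dimension, as `L` has injective
dimension at most `n`. Passing to a syzygy lowers `k` by one (`MonoCat.exists_syzygy`), so it
remains to see that the objects of `extBounded 0` are Gorenstein-projective. For them `X` is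
projective and the inclusion into `Y` splits, and the embedding of the orthogonal module `V` into a
free module `Q` yields an inflation of `X ⟶ Y` into the projective object `X ⟶ X × Q` with cokernel
`0 ⟶ W`, `W` orthogonal (`MonoCat.exists_cosyzygy`). Maps to projectives extend along all inflations
whose cokernel is in `extBounded 0` (`MonoCat.exists_extension`), so splicing syzygies and
cosyzygies gives complete resolutions (`isGorensteinProjective_of_class`).

That `mono L` is an exact category holds for the monomorphisms of any abelian category: deflations
are the componentwise epimorphisms, and pullbacks and pushouts are formed componentwise.
-/

namespace MonoGorenstein

universe v u w

/-! ### Short exact sequences of modules and vanishing of Ext -/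

section Modules

open Abelian

variable {L : Type u} [Ring L]
variable {A B C : Type u} [AddCommGroup A] [AddCommGroup B] [AddCommGroup C]
  [Module L A] [Module L B] [Module L C]

/-- The maps `f` and `g` form a short exact sequence `0 ⟶ A ⟶ B ⟶ C ⟶ 0` of modules. -/
structure IsSES (f : A →ₗ[L] B) (g : B →ₗ[L] C) : Prop where
  injective : Function.Injective f
  exact : Function.Exact f g
  surjective : Function.Surjective g

/-- `Ext^i(V, T) = 0` for all `i > k`. -/
def ExtVanish (L : Type u) [Ring L] (k : ℕ) (V T : Type u) [AddCommGroup V] [Module L V]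
    [AddCommGroup T] [Module L T] : Prop :=
  ∀ i, k < i → Subsingleton (Ext (ModuleCat.of L V) (ModuleCat.of L T) i)

variable {T : Type u} [AddCommGroup T] [Module L T]

theorem IsSES.comp_eq_zero {f : A →ₗ[L] B} {g : B →ₗ[L] C} (h : IsSES f g) : g ∘ₗ f = 0 :=
  h.exact.linearMap_comp_eq_zero

theorem IsSES.shortExact {f : A →ₗ[L] B} {g : B →ₗ[L] C} (h : IsSES f g) :
    (ModuleCat.shortComplexOfCompEqZero f g h.comp_eq_zero).ShortExact :=
  ModuleCat.shortComplex_shortExact _ h.exact h.injective h.surjective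

theorem isSES_ker {g : B →ₗ[L] C} (hg : Function.Surjective g) :
    IsSES (LinearMap.ker g).subtype g :=
  ⟨Subtype.val_injective, LinearMap.exact_subtype_ker_map g, hg⟩

theorem isSES_mkQ {f : A →ₗ[L] B} (hf : Function.Injective f) :
    IsSES f (LinearMap.range f).mkQ :=
  ⟨hf, LinearMap.exact_map_mkQ_range f, Submodule.mkQ_surjective _⟩

theorem IsSES.exists_desc {f : A →ₗ[L] B} {g : B →ₗ[L] C} (h : IsSES f g) {T : Type*}
    [AddCommGroup T] [Module L T] (c : B →ₗ[L] T) (hc : c ∘ₗ f = 0) :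
    ∃ e : C →ₗ[L] T, e ∘ₗ g = c := by
  have hle : LinearMap.ker g ≤ LinearMap.ker c := by
    intro x hx
    obtain ⟨y, rfl⟩ := (h.exact x).1 hx
    exact LinearMap.congr_fun hc y
  let e := g.quotKerEquivOfSurjective h.surjective
  refine ⟨(LinearMap.ker g).liftQ c hle ∘ₗ e.symm.toLinearMap, LinearMap.ext fun x => ?_⟩
  have : e.symm (g x) = (LinearMap.ker g).mkQ x := by
    rw [LinearEquiv.symm_apply_eq]; rfl
  simp [this]

theorem extVanish_of_projective [Module.Projective L A] : ExtVanish L 0 A T := by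
  intro i hi
  obtain ⟨i, rfl⟩ := Nat.exists_eq_succ_of_ne_zero hi.ne'
  have : Projective (ModuleCat.of L A) := (IsProjective.iff_projective A).1 inferInstance
  exact ⟨fun a b => (Ext.eq_zero_of_projective a).trans (Ext.eq_zero_of_projective b).symm⟩

theorem extVanish_of_injectiveDimension_le {n : ℕ}
    (h : injectiveDimension (ModuleCat.of L T) ≤ n) : ExtVanish L n A T := by
  intro i hi
  have := (injectiveDimension_le_iff _ _).1 h
  exact HasInjectiveDimensionLT.subsingleton (ModuleCat.of L T) (n + 1) i hi _

/-- Dimension shifting. The subtraction is truncated, so for `k = 0` this says that syzygies inherit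
the vanishing of all `Ext^i` with `i > 0`. -/
theorem IsSES.extVanish_left {f : A →ₗ[L] B} {g : B →ₗ[L] C} (h : IsSES f g)
    [Module.Projective L B] {k : ℕ} (hC : ExtVanish L k C T) : ExtVanish L (k - 1) A T := by
  intro i hi
  have := hC (1 + i) (by omega)
  have := extVanish_of_projective (L := L) (A := B) (T := T) i (by omega)
  refine subsingleton_of_forall_eq 0 fun x => ?_
  obtain ⟨y, rfl⟩ := Ext.contravariant_sequence_exact₁ h.shortExact _ x rfl
    (@Subsingleton.elim _ ‹_› _ _)
  rw [@Subsingleton.elim _ this y 0, Ext.comp_zero]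

theorem IsSES.extVanish_middle {f : A →ₗ[L] B} {g : B →ₗ[L] C} (h : IsSES f g) {k : ℕ}
    (hA : ExtVanish L k A T) (hC : ExtVanish L k C T) : ExtVanish L k B T := by
  intro i hi
  have := hA i hi
  have h3 := hC i hi
  refine subsingleton_of_forall_eq 0 fun x => ?_
  obtain ⟨y, rfl⟩ := Ext.contravariant_sequence_exact₂ h.shortExact _ x
    (@Subsingleton.elim _ ‹_› _ _)
  rw [@Subsingleton.elim _ h3 y 0, Ext.comp_zero]

/-- If `Ext^1(C, T) = 0`, then maps to `T` extend along a monomorphism with cokernel `C`. -/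
theorem IsSES.exists_extension {f : A →ₗ[L] B} {g : B →ₗ[L] C} (h : IsSES f g)
    (hC : ExtVanish L 0 C T) (a : A →ₗ[L] T) : ∃ b : B →ₗ[L] T, b ∘ₗ f = a := by
  have := hC (1 + 0) (by omega)
  obtain ⟨y, hy⟩ := Ext.contravariant_sequence_exact₁ h.shortExact _
    (Ext.mk₀ (ModuleCat.ofHom a)) rfl (@Subsingleton.elim _ ‹_› _ _)
  obtain ⟨b, rfl⟩ := (Ext.mk₀_bijective _ _).2 y
  rw [Ext.mk₀_comp_mk₀] at hy
  exact ⟨b.hom, congrArg ModuleCat.Hom.hom ((Ext.mk₀_bijective _ _).1 hy)⟩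

theorem IsSES.exists_extension_of_projective {f : A →ₗ[L] B} {g : B →ₗ[L] C} (h : IsSES f g)
    (hC : ExtVanish L 0 C L) {P : Type u} [AddCommGroup P] [Module L P] [Module.Finite L P]
    [Module.Projective L P] (a : A →ₗ[L] P) : ∃ b : B →ₗ[L] P, b ∘ₗ f = a := by
  obtain ⟨m, p, hp⟩ := Module.Finite.exists_fin' L P
  obtain ⟨s, hs⟩ := Module.projective_lifting_property p LinearMap.id hp
  choose b hb using fun i : Fin m => h.exists_extension hC (LinearMap.proj i ∘ₗ s ∘ₗ a)
  refine ⟨p ∘ₗ LinearMap.pi b, LinearMap.ext fun x => ?_⟩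
  have : LinearMap.pi b (f x) = s (a x) := funext fun i => LinearMap.congr_fun (hb i) x
  simp only [LinearMap.comp_apply, this]
  exact LinearMap.congr_fun hs (a x)

/-- If every map `A ⟶ T` extends along `f`, then the cokernel of `f` has no first extensions
by `T`. -/
theorem IsSES.extVanish_right {f : A →ₗ[L] B} {g : B →ₗ[L] C} (h : IsSES f g)
    [Module.Projective L B] (hA : ExtVanish L 0 A T)
    (hext : ∀ a : A →ₗ[L] T, ∃ b : B →ₗ[L] T, b ∘ₗ f = a) : ExtVanish L 0 C T := by
  intro i hi
  obtain ⟨i, rfl⟩ := Nat.exists_eq_add_of_le (Nat.succ_le_of_lt hi)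
  have hB := extVanish_of_projective (L := L) (A := B) (T := T) (0 + 1 + i) (by omega)
  refine subsingleton_of_forall_eq 0 fun x => ?_
  obtain ⟨y, rfl⟩ := Ext.contravariant_sequence_exact₃ h.shortExact _ x
    (@Subsingleton.elim _ ‹_› _ _) (n₀ := i) (by omega)
  obtain rfl | hi := Nat.eq_zero_or_pos i
  · obtain ⟨a, rfl⟩ := (Ext.mk₀_bijective _ _).2 y
    obtain ⟨b, hb⟩ := hext a.hom
    have : a = (ModuleCat.shortComplexOfCompEqZero f g h.comp_eq_zero).f ≫ ModuleCat.ofHom b :=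
      ModuleCat.hom_ext hb.symm
    rw [this, ← Ext.mk₀_comp_mk₀, ← Ext.comp_assoc_of_third_deg_zero, h.shortExact.extClass_comp,
      Ext.zero_comp]
  · rw [@Subsingleton.elim _ (hA i hi) y 0, Ext.comp_zero]

/-- Projective dimension at most `d` and `Ext^i(V, L) = 0` for `i > 0` force `V` to be projective:
by induction on `d` the first syzygy is projective, so the presentation of `V` splits. -/
theorem projective_of_hasProjectiveDimensionLE [IsNoetherianRing L] (d : ℕ) :
    ∀ (V : Type u) [AddCommGroup V] [Module L V] [Module.Finite L V],
      HasProjectiveDimensionLE (ModuleCat.of L V) d → ExtVanish L 0 V L →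
        Module.Projective L V := by
  induction d with
  | zero =>
    intro V _ _ _ h _
    exact (IsProjective.iff_projective _).2 ((projective_iff_hasProjectiveDimensionLE_zero _).2 h)
  | succ d ih =>
    intro V _ _ _ h hV
    obtain ⟨m, p, hp⟩ := Module.Finite.exists_fin' L V
    have hs := isSES_ker hp
    have : Projective (ModuleCat.of L (Fin m → L)) :=
      (IsProjective.iff_projective (R := L) (Fin m → L)).1 inferInstance
    have hd : HasProjectiveDimensionLE (ModuleCat.of L (LinearMap.ker p)) d :=
      hs.shortExact.hasProjectiveDimensionLT_X₁ (d + 1)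
        (inferInstanceAs (HasProjectiveDimensionLT (ModuleCat.of L (Fin m → L)) (d + 1))) h
    have := ih _ hd (hs.extVanish_left hV)
    obtain ⟨r, hr⟩ := hs.exists_extension_of_projective hV LinearMap.id
    obtain ⟨s, hs'⟩ :=
      ((hs.exact.split_tfae hs.injective hs.surjective).out 1 0 rfl rfl).1 ⟨r, hr⟩
    exact Module.Projective.of_split s p hs'

end Modules

/-! ### Duality between left and right modules -/

section Duality

variable {L : Type u} [Ring L]
variable {A B C : Type u} [AddCommGroup A] [AddCommGroup B] [AddCommGroup C]
  [Module L A] [Module L B] [Module L C]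

/-- The transpose `B* ⟶ A*` of a map `A ⟶ B` of left modules, as a map of right modules. Here
`V* = Hom_L(V, L)`, with the right multiplication of `L` on the values. -/
def transpose (f : A →ₗ[L] B) : (B →ₗ[L] L) →ₗ[Lᵐᵒᵖ] (A →ₗ[L] L) where
  toFun φ := φ ∘ₗ f
  map_add' _ _ := rfl
  map_smul' _ _ := rfl


/-- Evaluation at `x`, as a right linear functional on `V*`. -/
def evalAt (x : A) : (A →ₗ[L] L) →ₗ[Lᵐᵒᵖ] L where
  toFun φ := φ x
  map_add' _ _ := rfl
  map_smul' _ _ := rfl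

@[simp] theorem evalAt_apply (x : A) (φ : A →ₗ[L] L) : evalAt x φ = φ x := rfl

/-- The dual of a short exact sequence whose right-hand term has no first extensions by `L`. -/
theorem IsSES.transpose {f : A →ₗ[L] B} {g : B →ₗ[L] C} (h : IsSES f g)
    (hC : ExtVanish L 0 C L) : IsSES (transpose g) (transpose f) where
  injective φ ψ hφ := LinearMap.ext fun x => by
    obtain ⟨y, rfl⟩ := h.surjective x
    exact LinearMap.congr_fun hφ y
  exact φ := by
    constructor
    · intro hφ
      exact h.exists_desc φ hφ
    · rintro ⟨ψ, rfl⟩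
      exact LinearMap.ext fun x => (congrArg ψ (h.exact.apply_apply_eq_zero x)).trans (map_zero ψ)
  surjective := h.exists_extension hC

variable {m : ℕ}

/-- The dual of a free module of rank `m` is free of rank `m`. -/
def dualFreeEquiv (L : Type u) [Ring L] (m : ℕ) :
    ((Fin m → L) →ₗ[L] L) ≃ₗ[Lᵐᵒᵖ] (Fin m → Lᵐᵒᵖ) where
  toFun φ i := MulOpposite.op (φ (Pi.single i 1))
  map_add' _ _ := rfl
  map_smul' _ _ := by ext; simp
  invFun c := ∑ i, (LinearMap.toSpanSingleton L L (c i).unop) ∘ₗ LinearMap.proj i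
  left_inv φ := by
    ext i
    simp [Pi.single_apply]
  right_inv c := by
    ext i
    simp [Pi.single_apply]

instance : Module.Projective Lᵐᵒᵖ ((Fin m → L) →ₗ[L] L) :=
  Module.Projective.of_equiv (dualFreeEquiv L m).symm

/-- Finitely generated free modules are reflexive. -/
theorem exists_eq_evalAt (ψ : ((Fin m → L) →ₗ[L] L) →ₗ[Lᵐᵒᵖ] L) :
    ∃ q : Fin m → L, ψ = evalAt q := by
  refine ⟨fun i => ψ (LinearMap.proj i), LinearMap.ext fun φ => ?_⟩
  have hφ : φ = ∑ i, MulOpposite.op (φ (Pi.single i 1)) •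
      (LinearMap.proj i : (Fin m → L) →ₗ[L] L) := by
    ext i
    simp [Pi.single_apply]
  conv_lhs => rw [hφ]
  simp only [map_sum, map_smul, evalAt_apply, MulOpposite.smul_eq_mul_unop, MulOpposite.unop_op]
  conv_rhs => rw [← Finset.univ_sum_single fun i => ψ (LinearMap.proj i), map_sum]
  refine Finset.sum_congr rfl fun i _ => ?_
  have : (Pi.single i (ψ (LinearMap.proj i)) : Fin m → L) =
      ψ (LinearMap.proj i) • Pi.single i 1 := by
    rw [← Pi.single_smul', smul_eq_mul, mul_one]
  rw [this, map_smul, smul_eq_mul]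

/-- If `Ext^i(V, L) = 0` for all `i > 0`, then `V*` is a syzygy of arbitrarily high order, so finite
injective dimension of `L` on the right gives `Ext^i(V*, L) = 0` for all `i > 0`. -/
theorem extVanish_dual [IsNoetherianRing L] {n : ℕ}
    (hn : injectiveDimension (ModuleCat.of.{u} Lᵐᵒᵖ L) ≤ n) :
    ∀ (V : Type u) [AddCommGroup V] [Module L V] [Module.Finite L V],
      ExtVanish L 0 V L → ExtVanish Lᵐᵒᵖ 0 (V →ₗ[L] L) L := by
  suffices ∀ (k : ℕ) (V : Type u) [AddCommGroup V] [Module L V] [Module.Finite L V],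
      ExtVanish L 0 V L → ExtVanish Lᵐᵒᵖ (n - k) (V →ₗ[L] L) L by
    intro V _ _ _ hV
    simpa using this n V hV
  intro k
  induction k with
  | zero => exact fun V _ _ _ _ => extVanish_of_injectiveDimension_le hn
  | succ k ih =>
    intro V _ _ _ hV
    obtain ⟨m, p, hp⟩ := Module.Finite.exists_fin' L V
    have hs := isSES_ker hp
    rw [← Nat.sub_sub]
    exact (hs.transpose hV).extVanish_left (ih _ (hs.extVanish_left hV))

/-- Over a Gorenstein ring, modules `V` with `Ext^i(V, L) = 0` for all `i > 0` are torsionless. -/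
theorem eq_zero_of_forall_dual_eq_zero [IsNoetherianRing L] {n : ℕ}
    (hn : injectiveDimension (ModuleCat.of.{u} Lᵐᵒᵖ L) ≤ n)
    {V : Type u} [AddCommGroup V] [Module L V] [Module.Finite L V] (hV : ExtVanish L 0 V L)
    {x : V} (hx : ∀ φ : V →ₗ[L] L, φ x = 0) : x = 0 := by
  obtain ⟨m, p, hp⟩ := Module.Finite.exists_fin' L V
  have hs := isSES_ker hp
  have hK := hs.extVanish_left hV
  obtain ⟨m', p', hp'⟩ := Module.Finite.exists_fin' L (LinearMap.ker p)
  have hs' := isSES_ker hp'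
  have hK' := extVanish_dual hn _ (hs'.extVanish_left hK)
  obtain ⟨y, rfl⟩ := hp x
  -- Evaluation at `y` kills `V*`, so it descends to a functional `η` on the dual of the syzygy.
  have hd := hs.transpose hV
  obtain ⟨η, hη⟩ := hd.exists_desc (evalAt y) (LinearMap.ext hx)
  obtain ⟨ψ, hψ⟩ := (hs'.transpose hK).exists_extension hK' η
  obtain ⟨q, rfl⟩ := exists_eq_evalAt ψ
  have hyq : y = (p' q : Fin m → L) := by
    funext i
    have := LinearMap.congr_fun hψ (transpose (LinearMap.ker p).subtype (LinearMap.proj i))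
    exact (this.trans (LinearMap.congr_fun hη _)).symm
  rw [hyq]
  exact (p' q).2

/-- Over a Gorenstein Artin algebra a finitely generated module `V` with `Ext^i(V, L) = 0` for all
`i > 0` embeds into a free module such that the cokernel has the same property. -/
theorem exists_embedding_of_extVanish {R : Type w} [CommRing R] [IsNoetherianRing R] [Algebra R L]
    [Module.Finite R L] [IsNoetherianRing L] {n : ℕ}
    (hn : injectiveDimension (ModuleCat.of.{u} Lᵐᵒᵖ L) ≤ n)
    {V : Type u} [AddCommGroup V] [Module L V] [Module.Finite L V] (hV : ExtVanish L 0 V L) :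
    ∃ (m : ℕ) (j : V →ₗ[L] (Fin m → L)), Function.Injective j ∧
      ExtVanish L 0 ((Fin m → L) ⧸ LinearMap.range j) L := by
  -- The dual of `V` is finitely generated over `R`; its generators are the components of `j`.
  have hfin : Module.Finite R (V →ₗ[L] L) := by
    obtain ⟨m, p, hp⟩ := Module.Finite.exists_fin' L V
    let F : (V →ₗ[L] L) →ₗ[R] (Fin m → L) :=
      { toFun := fun φ i => φ (p (Pi.single i 1))
        map_add' := fun _ _ => rfl
        map_smul' := fun _ _ => rfl }
    have : IsNoetherian R L := isNoetherian_of_isNoetherianRing_of_finite R L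
    refine Module.Finite.of_injective F fun φ ψ h => ?_
    refine LinearMap.cancel_right hp |>.1 ?_
    ext i
    exact congrFun h i
  obtain ⟨m, c, hc⟩ := Module.Finite.exists_fin' R (V →ₗ[L] L)
  let j : V →ₗ[L] (Fin m → L) := LinearMap.pi fun i => c (Pi.single i 1)
  have hext : ∀ a : V →ₗ[L] L, ∃ b : (Fin m → L) →ₗ[L] L, b ∘ₗ j = a := by
    intro a
    obtain ⟨r, rfl⟩ := hc a
    refine ⟨∑ i, r i • LinearMap.proj i, LinearMap.ext fun x => ?_⟩
    conv_rhs => rw [← Finset.univ_sum_single r]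
    simp only [LinearMap.comp_apply, LinearMap.sum_apply, map_sum, LinearMap.smul_apply,
      LinearMap.proj_apply, j, LinearMap.pi_apply]
    refine Finset.sum_congr rfl fun i _ => ?_
    rw [← LinearMap.smul_apply, ← map_smul, ← Pi.single_smul', smul_eq_mul, mul_one]
  have hj : Function.Injective j := by
    refine (injective_iff_map_eq_zero j).2 fun x hx => ?_
    refine eq_zero_of_forall_dual_eq_zero hn hV fun φ => ?_
    obtain ⟨b, rfl⟩ := hext φ
    simp [hx]
  exact ⟨m, j, hj, (isSES_mkQ hj).extVanish_right hV hext⟩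

end Duality

/-! ### The exact structure on the monomorphism category -/

section MonoCategory

namespace MonoCat

section

variable {A : Type u} [Category.{v} A] [Preadditive A]

/-- The object of the monomorphism category given by a monomorphism. -/
def mk {X Y : A} (f : X ⟶ Y) [Mono f] : MonoCat A :=
  ⟨⟨X, Y, f, 0, by simp, by simp⟩, ‹_›, rfl⟩

instance (M : MonoCat A) : Mono M.obj.f := M.property.1

/-- Morphisms of the monomorphism category are commutative squares. -/
def homMk {M N : MonoCat A} (a : M.obj.X ⟶ N.obj.X) (b : M.obj.Y ⟶ N.obj.Y)
    (comm : M.obj.f ≫ b = a ≫ N.obj.f) : M ⟶ N :=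
  ObjectProperty.homMk ⟨a, b, comm, by rw [M.property.2, N.property.2, zero_comp, comp_zero]⟩

variable {M N K : MonoCat A}



/-- A morphism is determined by its second component, because the structure map of the target is
a monomorphism. -/
theorem hom_ext {u w : M ⟶ N} (h : u.hom.b = w.hom.b) : u = w := by
  refine ObjectProperty.hom_ext _ (DMor.hom_ext ?_ h)
  rw [← cancel_mono N.obj.f, ← u.hom.comm_f, ← w.hom.comm_f, h]


theorem isZero_of_isZero_Y (h : IsZero M.obj.Y) : IsZero M := by
  rw [IsZero.iff_id_eq_zero]
  exact hom_ext (h.eq_of_src _ _)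

theorem isZero_X (h : IsZero M) : IsZero M.obj.X := by
  rw [IsZero.iff_id_eq_zero]
  exact congrArg (fun u : M ⟶ M => u.hom.a) ((IsZero.iff_id_eq_zero _).1 h)

end

variable {A : Type u} [Category.{v} A] [Abelian A]

open ZeroObject in
instance : HasZeroObject (MonoCat A) :=
  ⟨⟨mk (𝟙 (0 : A)), isZero_of_isZero_Y (isZero_zero A)⟩⟩

theorem hasFiniteBiproducts : HasFiniteBiproducts (MonoCat A) := by
  have : HasBinaryBiproducts (MonoCat A) := by
    refine ⟨fun M N => ⟨⟨?_⟩⟩⟩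
    have : Mono (biprod.map M.obj.f N.obj.f) := inferInstance
    let b : BinaryBicone M N :=
      { pt := mk (biprod.map M.obj.f N.obj.f)
        fst := homMk biprod.fst biprod.fst (biprod.map_fst _ _)
        snd := homMk biprod.snd biprod.snd (biprod.map_snd _ _)
        inl := homMk biprod.inl biprod.inl (biprod.inl_map _ _).symm
        inr := homMk biprod.inr biprod.inr (biprod.inr_map _ _).symm
        inl_fst := hom_ext biprod.inl_fst
        inl_snd := hom_ext biprod.inl_snd
        inr_fst := hom_ext biprod.inr_fst
        inr_snd := hom_ext biprod.inr_snd }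
    exact ⟨b, isBinaryBilimitOfTotal b (hom_ext biprod.total)⟩
  have : HasFiniteProducts (MonoCat A) := hasFiniteProducts_of_has_binary_and_terminal
  exact HasFiniteBiproducts.of_hasFiniteProducts

variable {S : ShortComplex (MonoCat A)}

theorem isExactPair (h : monoConflations A S) : IsExactPair S := by
  obtain ⟨h₁, h₂⟩ := h
  have w₁ : S.f.hom.a ≫ S.g.hom.a = 0 := ((S.map (isMono A).ι).map DMor.U₁).zero
  have w₂ : S.f.hom.b ≫ S.g.hom.b = 0 := ((S.map (isMono A).ι).map DMor.U₂).zero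
  have : Mono S.f.hom.a := h₁.mono_f
  have : Mono S.f.hom.b := h₂.mono_f
  have : Epi S.g.hom.a := h₁.epi_g
  have : Epi S.g.hom.b := h₂.epi_g
  have k₁ : IsLimit (KernelFork.ofι S.f.hom.a w₁) := h₁.fIsKernel
  have k₂ : IsLimit (KernelFork.ofι S.f.hom.b w₂) := h₂.fIsKernel
  have c₁ : IsColimit (CokernelCofork.ofπ S.g.hom.a w₁) := h₁.gIsCokernel
  have c₂ : IsColimit (CokernelCofork.ofπ S.g.hom.b w₂) := h₂.gIsCokernel
  refine ⟨⟨?_⟩, ⟨?_⟩⟩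
  · have hlift : ∀ {T : MonoCat A} (t : T ⟶ S.X₂), t ≫ S.g = 0 →
        Nonempty { l : T ⟶ S.X₁ // l ≫ S.f = t } := by
      intro T t ht
      obtain ⟨a, ha⟩ := KernelFork.IsLimit.lift' k₁ t.hom.a
        (congrArg (fun u : T ⟶ S.X₃ => u.hom.a) ht)
      obtain ⟨b, hb⟩ := KernelFork.IsLimit.lift' k₂ t.hom.b
        (congrArg (fun u : T ⟶ S.X₃ => u.hom.b) ht)
      simp only [Fork.ι_ofι] at ha hb
      refine ⟨homMk a b ?_, hom_ext hb⟩
      rw [← cancel_mono S.f.hom.b, Category.assoc, hb, Category.assoc, S.f.hom.comm_f,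
        ← Category.assoc, ha, t.hom.comm_f]
    have : Mono S.f := ⟨fun u w huw => hom_ext <| by
      rw [← cancel_mono S.f.hom.b]
      exact congrArg (fun u => u.hom.b) huw⟩
    exact KernelFork.IsLimit.ofι' _ _ fun t ht => (hlift t ht).some
  · have hdesc : ∀ {T : MonoCat A} (t : S.X₂ ⟶ T), S.f ≫ t = 0 →
        Nonempty { l : S.X₃ ⟶ T // S.g ≫ l = t } := by
      intro T t ht
      obtain ⟨a, ha⟩ := CokernelCofork.IsColimit.desc' c₁ t.hom.a
        (congrArg (fun u : S.X₁ ⟶ T => u.hom.a) ht)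
      obtain ⟨b, hb⟩ := CokernelCofork.IsColimit.desc' c₂ t.hom.b
        (congrArg (fun u : S.X₁ ⟶ T => u.hom.b) ht)
      simp only [Cofork.π_ofπ] at ha hb
      refine ⟨homMk a b ?_, hom_ext hb⟩
      rw [← cancel_epi S.g.hom.a, ← Category.assoc, ← S.g.hom.comm_f, Category.assoc, hb,
        ← Category.assoc, ha, t.hom.comm_f]
    have : Epi S.g := ⟨fun u w huw => hom_ext <| by
      rw [← cancel_epi S.g.hom.b]
      exact congrArg (fun u => u.hom.b) huw⟩
    exact CokernelCofork.IsColimit.ofπ' _ _ fun t ht => (hdesc t ht).some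

variable {M N K : MonoCat A}

theorem shortExact_kernel {X Y : A} (g : X ⟶ Y) [Epi g] :
    (ShortComplex.mk (kernel.ι g) g (kernel.condition g)).ShortExact where
  exact := ShortComplex.exact_kernel g

/-- The deflations are the componentwise epimorphisms. -/
theorem isDeflation_iff {g : M ⟶ N} :
    IsDeflation (monoConflations A) g ↔ Epi g.hom.a ∧ Epi g.hom.b := by
  constructor
  · rintro ⟨K, f, w, h₁, h₂⟩
    exact ⟨h₁.epi_g, h₂.epi_g⟩
  · rintro ⟨h₁, h₂⟩
    let k : kernel g.hom.a ⟶ kernel g.hom.b := kernel.map _ _ _ _ g.hom.comm_f.symm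
    have hk : k ≫ kernel.ι g.hom.b = kernel.ι g.hom.a ≫ M.obj.f := kernel.lift_ι _ _ _
    have : Mono (k ≫ kernel.ι g.hom.b) := by rw [hk]; infer_instance
    have : Mono k := mono_of_mono k (kernel.ι g.hom.b)
    refine ⟨mk k, homMk (kernel.ι _) (kernel.ι _) hk, hom_ext (kernel.condition _), ?_, ?_⟩
    · exact shortExact_kernel g.hom.a
    · exact shortExact_kernel g.hom.b

theorem exists_pullback (g : M ⟶ N) (c : K ⟶ N) (hg : IsDeflation (monoConflations A) g) :
    ∃ (Y : MonoCat A) (c' : Y ⟶ M) (g' : Y ⟶ K), IsPullback c' g' g c ∧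
      IsDeflation (monoConflations A) g' := by
  obtain ⟨h₁, h₂⟩ := isDeflation_iff.1 hg
  let p : pullback g.hom.a c.hom.a ⟶ pullback g.hom.b c.hom.b :=
    pullback.map _ _ _ _ M.obj.f K.obj.f N.obj.f g.hom.comm_f.symm c.hom.comm_f.symm
  have hp₁ : p ≫ pullback.fst _ _ = pullback.fst _ _ ≫ M.obj.f := pullback.lift_fst _ _ _
  have hp₂ : p ≫ pullback.snd _ _ = pullback.snd _ _ ≫ K.obj.f := pullback.lift_snd _ _ _
  have : Mono p := ⟨fun u w huw => by
    refine pullback.hom_ext ?_ ?_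
    · rw [← cancel_mono M.obj.f, Category.assoc, Category.assoc, ← hp₁, reassoc_of% huw]
    · rw [← cancel_mono K.obj.f, Category.assoc, Category.assoc, ← hp₂, reassoc_of% huw]⟩
  let c' : mk p ⟶ M := homMk (pullback.fst _ _) (pullback.fst _ _) hp₁
  let g' : mk p ⟶ K := homMk (pullback.snd _ _) (pullback.snd _ _) hp₂
  have hw : c' ≫ g = g' ≫ c := hom_ext pullback.condition
  have hlift : ∀ {T : MonoCat A} (s : T ⟶ M) (t : T ⟶ K), s ≫ g = t ≫ c →
      ∃ l : T ⟶ mk p, l ≫ c' = s ∧ l ≫ g' = t := by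
    intro T s t hst
    have ha : s.hom.a ≫ g.hom.a = t.hom.a ≫ c.hom.a := congrArg (fun u => u.hom.a) hst
    have hb : s.hom.b ≫ g.hom.b = t.hom.b ≫ c.hom.b := congrArg (fun u => u.hom.b) hst
    have comm : T.obj.f ≫ pullback.lift _ _ hb = pullback.lift _ _ ha ≫ p := by
      apply pullback.hom_ext
      · rw [Category.assoc, pullback.lift_fst, Category.assoc, hp₁, pullback.lift_fst_assoc,
          s.hom.comm_f]
      · rw [Category.assoc, pullback.lift_snd, Category.assoc, hp₂, pullback.lift_snd_assoc,
          t.hom.comm_f]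
    exact ⟨homMk _ _ comm, hom_ext (pullback.lift_fst _ _ _), hom_ext (pullback.lift_snd _ _ _)⟩
  choose l hl₁ hl₂ using @hlift
  refine ⟨mk p, c', g', ⟨⟨hw⟩, ⟨PullbackCone.IsLimit.mk hw (fun s => l s.fst s.snd s.condition)
    (fun s => hl₁ _ _ _) (fun s => hl₂ _ _ _) fun s m hm₁ hm₂ => hom_ext ?_⟩⟩, ?_⟩
  · refine pullback.hom_ext ?_ ?_
    · exact congrArg (fun u => u.hom.b) (hm₁.trans (hl₁ s.fst s.snd s.condition).symm)
    · exact congrArg (fun u => u.hom.b) (hm₂.trans (hl₂ s.fst s.snd s.condition).symm)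
  · exact isDeflation_iff.2 ⟨inferInstanceAs (Epi (pullback.snd g.hom.a c.hom.a)),
      inferInstanceAs (Epi (pullback.snd g.hom.b c.hom.b))⟩

/-- The pushout of a monomorphism along a map has the same cokernel. -/
theorem shortExact_pushout {X Y Z X' : A} {f : X ⟶ Y} {g : Y ⟶ Z} (w : f ≫ g = 0)
    (h : (ShortComplex.mk f g w).ShortExact) (a : X ⟶ X') :
    (ShortComplex.mk (pushout.inr f a) (pushout.desc g (0 : X' ⟶ Z) (by simp [w]))
      (pushout.inr_desc _ _ _)).ShortExact := by
  have : Mono f := h.mono_f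
  have : Epi g := h.epi_g
  have : Epi (pushout.inl f a ≫ pushout.desc g (0 : X' ⟶ Z) (by simp [w])) := by
    rw [pushout.inl_desc]; infer_instance
  have : Epi (pushout.desc g (0 : X' ⟶ Z) (by simp [w] : f ≫ g = a ≫ 0)) :=
    epi_of_epi (pushout.inl f a) _
  refine { exact := ShortComplex.exact_of_g_is_cokernel _ ?_ }
  have c : IsColimit (CokernelCofork.ofπ g w) := h.gIsCokernel
  refine CokernelCofork.IsColimit.ofπ' _ _ fun {T} t ht => ?_
  let l := CokernelCofork.IsColimit.desc' c (pushout.inl f a ≫ t)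
    (by rw [← Category.assoc, pushout.condition, Category.assoc, ht, comp_zero])
  refine ⟨l.1, pushout.hom_ext ?_ ?_⟩
  · rw [pushout.inl_desc_assoc]
    exact l.2
  · rw [pushout.inr_desc_assoc, zero_comp, ht]

theorem exists_pushout (f : M ⟶ N) (a : M ⟶ K) (hf : IsInflation (monoConflations A) f) :
    ∃ (Y : MonoCat A) (a' : N ⟶ Y) (f' : K ⟶ Y), IsPushout f a a' f' ∧
      IsInflation (monoConflations A) f' := by
  obtain ⟨Z, g, w, h₁, h₂⟩ := hf
  have w₁ : f.hom.a ≫ g.hom.a = 0 := congrArg (fun u : M ⟶ Z => u.hom.a) w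
  have w₂ : f.hom.b ≫ g.hom.b = 0 := congrArg (fun u : M ⟶ Z => u.hom.b) w
  have e₁ := shortExact_pushout w₁ h₁ a.hom.a
  have e₂ := shortExact_pushout w₂ h₂ a.hom.b
  let p : pushout f.hom.a a.hom.a ⟶ pushout f.hom.b a.hom.b :=
    pushout.map _ _ _ _ N.obj.f K.obj.f M.obj.f f.hom.comm_f.symm a.hom.comm_f.symm
  have hp₁ : pushout.inl _ _ ≫ p = N.obj.f ≫ pushout.inl _ _ := pushout.inl_desc _ _ _
  have hp₂ : pushout.inr _ _ ≫ p = K.obj.f ≫ pushout.inr _ _ := pushout.inr_desc _ _ _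
  have hp₃ : p ≫ pushout.desc g.hom.b (0 : K.obj.Y ⟶ Z.obj.Y) (by simp [w₂]) =
      pushout.desc g.hom.a (0 : K.obj.X ⟶ Z.obj.X) (by simp [w₁]) ≫ Z.obj.f := by
    apply pushout.hom_ext
    · rw [← Category.assoc, hp₁, Category.assoc, pushout.inl_desc, pushout.inl_desc_assoc,
        g.hom.comm_f]
    · rw [← Category.assoc, hp₂, Category.assoc, pushout.inr_desc, pushout.inr_desc_assoc]
      simp
  have : Mono p := ShortComplex.mono_of_mono_of_mono_of_mono
    (ShortComplex.Hom.mk K.obj.f p Z.obj.f hp₂.symm hp₃ :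
      ShortComplex.mk _ _ _ ⟶ ShortComplex.mk _ _ _) e₁.exact e₂.mono_f
    (inferInstanceAs (Mono K.obj.f)) (inferInstanceAs (Mono Z.obj.f))
  let a' : N ⟶ mk p := homMk (pushout.inl _ _) (pushout.inl _ _) hp₁.symm
  let f' : K ⟶ mk p := homMk (pushout.inr _ _) (pushout.inr _ _) hp₂.symm
  let g' : mk p ⟶ Z := homMk _ _ hp₃
  have hw : f ≫ a' = a ≫ f' := hom_ext pushout.condition
  have hdesc : ∀ {T : MonoCat A} (s : N ⟶ T) (t : K ⟶ T), f ≫ s = a ≫ t →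
      ∃ l : mk p ⟶ T, a' ≫ l = s ∧ f' ≫ l = t := by
    intro T s t hst
    have ha : f.hom.a ≫ s.hom.a = a.hom.a ≫ t.hom.a := congrArg (fun u => u.hom.a) hst
    have hb : f.hom.b ≫ s.hom.b = a.hom.b ≫ t.hom.b := congrArg (fun u => u.hom.b) hst
    have comm : p ≫ pushout.desc _ _ hb = pushout.desc _ _ ha ≫ T.obj.f := by
      apply pushout.hom_ext
      · rw [← Category.assoc, ← Category.assoc, hp₁, Category.assoc, pushout.inl_desc,
          pushout.inl_desc, s.hom.comm_f]
      · rw [← Category.assoc, ← Category.assoc, hp₂, Category.assoc, pushout.inr_desc,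
          pushout.inr_desc, t.hom.comm_f]
    exact ⟨homMk _ _ comm, hom_ext (pushout.inl_desc _ _ _), hom_ext (pushout.inr_desc _ _ _)⟩
  choose l hl₁ hl₂ using @hdesc
  refine ⟨mk p, a', f', ⟨⟨hw⟩, ⟨PushoutCocone.IsColimit.mk hw (fun s => l s.inl s.inr s.condition)
    (fun s => hl₁ _ _ _) (fun s => hl₂ _ _ _) fun s m hm₁ hm₂ => hom_ext ?_⟩⟩, ?_⟩
  · refine pushout.hom_ext ?_ ?_
    · exact congrArg (fun u => u.hom.b) (hm₁.trans (hl₁ s.inl s.inr s.condition).symm)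
    · exact congrArg (fun u => u.hom.b) (hm₂.trans (hl₂ s.inl s.inr s.condition).symm)
  · exact ⟨Z, g', hom_ext (pushout.inr_desc _ _ _), e₁, e₂⟩

variable (A) in
theorem isExactCategory : IsExactCategory (monoConflations A) where
  hasFiniteBiproducts := hasFiniteBiproducts
  isExactPair _ := isExactPair
  closedUnderIso S T := by
    rintro ⟨e⟩ ⟨h₁, h₂⟩
    let e' := (isMono A).ι.mapShortComplex.mapIso e
    exact ⟨ShortComplex.shortExact_of_iso (DMor.U₁.mapShortComplex.mapIso e') h₁,
      ShortComplex.shortExact_of_iso (DMor.U₂.mapShortComplex.mapIso e') h₂⟩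
  id_zero Z _ := isDeflation_iff.2
    ⟨inferInstanceAs (Epi (𝟙 Z.obj.X)), inferInstanceAs (Epi (𝟙 Z.obj.Y))⟩
  comp_deflation f g hf hg := by
    rw [isDeflation_iff] at hf hg ⊢
    obtain ⟨_, _⟩ := hf
    obtain ⟨_, _⟩ := hg
    exact ⟨epi_comp f.hom.a g.hom.a, epi_comp f.hom.b g.hom.b⟩
  pullback_deflation := exists_pullback
  pushout_inflation := exists_pushout

end MonoCat

end MonoCategory

/-! ### Complete resolutions from classes of objects -/

section CompleteResolutions

/-- A relation in which every element has a successor and a predecessor admits two-sided infinite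
chains through every element. -/
theorem exists_int_chain {α : Type*} (r : α → α → Prop) (hs : ∀ x, ∃ y, r x y)
    (hp : ∀ x, ∃ y, r y x) (x : α) : ∃ z : ℤ → α, z 1 = x ∧ ∀ i, r (z i) (z (i + 1)) := by
  choose s hs using hs
  choose p hp using hp
  let z : ℤ → α := fun i => match i with
    | Int.ofNat k => s^[k] x
    | Int.negSucc k => p^[k + 1] x
  have hz : ∀ i, r (z i) (z (i + 1)) := by
    rintro (k | k)
    · have : z (Int.ofNat k + 1) = s (z (Int.ofNat k)) := Function.iterate_succ_apply' s k x
      exact this ▸ hs _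
    · have h : z (Int.negSucc k) = p (z (Int.negSucc k + 1)) := by
        cases k with
        | zero => rfl
        | succ k => exact Function.iterate_succ_apply' p (k + 1) x
      exact h ▸ hp _
  refine ⟨fun i => z (i - 1), rfl, fun i => ?_⟩
  have : i + 1 - 1 = i - 1 + 1 := by ring
  simpa only [this] using hz (i - 1)

variable {C : Type u} [Category.{v} C] [Preadditive C]

/-- Suppose that every object of the class `G` is the kernel and the cokernel of conflations with
projective middle term and remaining term in `G`, and that maps to projectives extend along
inflations with cokernel in `G`. Splicing conflations gives a complete resolution of every object
of `G`. -/
theorem isGorensteinProjective_of_class {E : ObjectProperty (ShortComplex C)}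
    (hE : ∀ S, E S → IsExactPair S) (G : ObjectProperty C)
    (hright : ∀ W, G W → ∃ (P W' : C) (ι : W ⟶ P) (π : P ⟶ W') (h : ι ≫ π = 0),
      E (ShortComplex.mk ι π h) ∧ IsProjectiveObj E P ∧ G W')
    (hleft : ∀ W, G W → ∃ (W' P : C) (ι : W' ⟶ P) (π : P ⟶ W) (h : ι ≫ π = 0),
      E (ShortComplex.mk ι π h) ∧ IsProjectiveObj E P ∧ G W')
    (hext : ∀ S : ShortComplex C, E S → G S.X₃ → ∀ T, IsProjectiveObj E T →
      ∀ a : S.X₁ ⟶ T, ∃ b : S.X₂ ⟶ T, S.f ≫ b = a)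
    {W : C} (hW : G W) : IsGorensteinProjective E W := by
  obtain ⟨Z, hZ, hr⟩ := exists_int_chain
    (fun V V' : { V : C // G V } => ∃ (P : C) (ι : V.1 ⟶ P) (π : P ⟶ V'.1) (h : ι ≫ π = 0),
      E (ShortComplex.mk ι π h) ∧ IsProjectiveObj E P)
    (fun V => by
      obtain ⟨P, W', ι, π, h, hS, hP, hW'⟩ := hright V.1 V.2
      exact ⟨⟨W', hW'⟩, P, ι, π, h, hS, hP⟩)
    (fun V => by
      obtain ⟨W', P, ι, π, h, hS, hP, hW'⟩ := hleft V.1 V.2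
      exact ⟨⟨W', hW'⟩, P, ι, π, h, hS, hP⟩) ⟨W, hW⟩
  obtain rfl : (Z 1).1 = W := congrArg Subtype.val hZ
  choose P ι π h hS hP using hr
  let K : CochainComplex C ℤ := CochainComplex.of P (fun i => π i ≫ ι (i + 1)) fun i => by
    rw [Category.assoc, reassoc_of% (h (i + 1)), zero_comp, comp_zero]
  have hd : ∀ i, K.d i (i + 1) = π i ≫ ι (i + 1) := CochainComplex.of_d _ _
  refine ⟨K, hP, ⟨fun i => (Z i).1, ι, π, h, hS, hd⟩, fun T hT i => ?_,
    π 0, ι 1, ⟨_, ι 0, h 0, hS 0⟩, ⟨_, π 1, h 1, hS 1⟩, hd 0⟩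
  intro a
  constructor
  · intro ha
    have hι : ι (i + 1) ≫ a = 0 := by
      obtain ⟨c⟩ := (hE _ (hS i)).2
      refine Cofork.IsColimit.hom_ext c ?_
      change π i ≫ ι (i + 1) ≫ a = π i ≫ 0
      rw [comp_zero, ← Category.assoc, ← hd]
      exact ha
    obtain ⟨c⟩ := (hE _ (hS (i + 1))).2
    obtain ⟨b, hb⟩ := CokernelCofork.IsColimit.desc' c a hι
    obtain ⟨t, rfl⟩ := hext _ (hS (i + 1 + 1)) (Z (i + 1 + 1 + 1)).2 T hT b
    refine ⟨t, ?_⟩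
    change K.d (i + 1) (i + 1 + 1) ≫ t = a
    rw [hd, Category.assoc]
    exact hb
  · rintro ⟨b, rfl⟩
    change K.d i (i + 1) ≫ K.d (i + 1) (i + 1 + 1) ≫ b = 0
    rw [K.d_comp_d_assoc, zero_comp]

end CompleteResolutions

/-! ### Monomorphisms of finitely generated modules -/

section ModuleMonos

variable {L : Type u} [Ring L]

theorem projectiveDimension_lt_top_iff {X : ModuleCat.{u} L} :
    projectiveDimension X < ⊤ ↔ ∃ d, HasProjectiveDimensionLE X d := by
  constructor
  · intro h
    obtain ⟨d, hd⟩ := (projectiveDimension_ne_top_iff X).1 h.ne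
    exact ⟨d, inferInstance⟩
  · rintro ⟨d, hd⟩
    exact lt_of_le_of_lt ((projectiveDimension_le_iff X d).2 hd)
      (WithBot.coe_lt_coe.2 (ENat.natCast_lt_top d))

namespace MonoCat

/-- The structure map of an object of the monomorphism category, as a linear map. -/
abbrev incl (M : mono L) : M.obj.X →ₗ[L] M.obj.Y := M.obj.f.hom.hom

theorem incl_comm {M N : mono L} (u : M ⟶ N) :
    u.hom.b.hom.hom ∘ₗ M.incl = N.incl ∘ₗ u.hom.a.hom.hom :=
  congrArg (fun t => t.hom.hom) u.hom.comm_f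

theorem coprod_surjective {P Q : Type u} [AddCommGroup P] [Module L P] [AddCommGroup Q]
    [Module L Q] {M : mono L} (p : P →ₗ[L] M.obj.X) {q : Q →ₗ[L] M.obj.Y}
    (hq : Function.Surjective q) :
    Function.Surjective (LinearMap.coprod (M.incl ∘ₗ p) q) := fun y => by
  obtain ⟨z, rfl⟩ := hq y
  exact ⟨(0, z), by simp⟩

theorem finiteProjDim_of_projective (M : mono L) [Module.Projective L M.obj.X] :
    finiteProjDim L M := by
  refine projectiveDimension_lt_top_iff.2 ⟨0, ?_⟩
  exact (projective_iff_hasProjectiveDimensionLE_zero _).1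
    ((IsProjective.iff_projective (R := L) M.obj.X).1 inferInstance)

end MonoCat

variable [IsNoetherianRing L]

theorem shortExact_iff_isSES {S : ShortComplex (FGModuleCat.{u} L)} :
    S.ShortExact ↔ IsSES S.f.hom.hom S.g.hom.hom := by
  rw [← ShortExact.shortExact_map_iff (forget₂ (FGModuleCat.{u} L) (ModuleCat.{u} L))]
  constructor
  · intro h
    exact ⟨h.moduleCat_injective_f,
      (ShortComplex.ShortExact.moduleCat_exact_iff_function_exact _).1 h.exact,
      h.moduleCat_surjective_g⟩
  · intro h
    exact ModuleCat.shortComplex_shortExact _ h.exact h.injective h.surjective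

namespace MonoCat

theorem isSES_of_conflation {S : ShortComplex (mono L)}
    (h : monoConflations (FGModuleCat.{u} L) S) :
    IsSES S.f.hom.a.hom.hom S.g.hom.a.hom.hom ∧ IsSES S.f.hom.b.hom.hom S.g.hom.b.hom.hom :=
  ⟨shortExact_iff_isSES.1 h.1, shortExact_iff_isSES.1 h.2⟩

theorem conflation_of_isSES {S : ShortComplex (mono L)}
    (h₁ : IsSES S.f.hom.a.hom.hom S.g.hom.a.hom.hom)
    (h₂ : IsSES S.f.hom.b.hom.hom S.g.hom.b.hom.hom) :
    monoConflations (FGModuleCat.{u} L) S :=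
  ⟨shortExact_iff_isSES.2 h₁, shortExact_iff_isSES.2 h₂⟩

theorem incl_injective (M : mono L) : Function.Injective M.incl :=
  (ModuleCat.mono_iff_injective _).1
    (inferInstanceAs (Mono ((forget₂ (FGModuleCat.{u} L) (ModuleCat.{u} L)).map M.obj.f)))

/-- The object of the monomorphism category given by an injective linear map. -/
def ofInjective {X Y : Type u} [AddCommGroup X] [Module L X] [Module.Finite L X]
    [AddCommGroup Y] [Module L Y] [Module.Finite L Y] (f : X →ₗ[L] Y)
    (hf : Function.Injective f) : mono L :=
  have : Mono (FGModuleCat.ofHom f) :=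
    (forget₂ (FGModuleCat.{u} L) (ModuleCat.{u} L)).mono_of_mono_map
      ((ModuleCat.mono_iff_injective (ModuleCat.ofHom f)).2 hf)
  MonoCat.mk (FGModuleCat.ofHom f)

/-- Morphisms of the monomorphism category given by linear maps. -/
def homOfLinear {M N : mono L} (a : M.obj.X →ₗ[L] N.obj.X) (b : M.obj.Y →ₗ[L] N.obj.Y)
    (comm : b ∘ₗ M.incl = N.incl ∘ₗ a) : M ⟶ N :=
  homMk (ObjectProperty.homMk (ModuleCat.ofHom a)) (ObjectProperty.homMk (ModuleCat.ofHom b))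
    (FGModuleCat.hom_ext comm)

/-- A morphism of the monomorphism category with surjective components is a deflation. -/
theorem isDeflation_of_surjective {M N : mono L} (u : M ⟶ N)
    (ha : Function.Surjective u.hom.a.hom.hom) (hb : Function.Surjective u.hom.b.hom.hom) :
    IsDeflation (monoConflations (FGModuleCat.{u} L)) u :=
  isDeflation_iff.2
    ⟨(forget₂ (FGModuleCat.{u} L) (ModuleCat.{u} L)).epi_of_epi_map
      ((ModuleCat.epi_iff_surjective u.hom.a.hom).2 ha),
    (forget₂ (FGModuleCat.{u} L) (ModuleCat.{u} L)).epi_of_epi_map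
      ((ModuleCat.epi_iff_surjective u.hom.b.hom).2 hb)⟩

/-! ### Projective objects of the monomorphism category -/

section Projectives

variable (P Q : Type u) [AddCommGroup P] [Module L P] [Module.Finite L P]
  [AddCommGroup Q] [Module L Q] [Module.Finite L Q]

/-- The inclusion of the first summand `P ⟶ P × Q`, as an object of the monomorphism category. It is
the sum of `P = P` and `0 ⟶ Q`, hence projective if `P` and `Q` are. -/
def summand : mono L := ofInjective (LinearMap.inl L P Q) LinearMap.inl_injective

theorem isProjectiveObj_summand [Module.Projective L P] [Module.Projective L Q] :
    IsProjectiveObj (monoConflations (FGModuleCat.{u} L)) (summand (L := L) P Q) := by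
  intro S hS t
  obtain ⟨h₁, h₂⟩ := isSES_of_conflation hS
  let ta : P →ₗ[L] S.X₃.obj.X := t.hom.a.hom.hom
  let tb : P × Q →ₗ[L] S.X₃.obj.Y := t.hom.b.hom.hom
  have ht : tb ∘ₗ LinearMap.inl L P Q = S.X₃.incl ∘ₗ ta := incl_comm t
  obtain ⟨a, ha⟩ := Module.projective_lifting_property _ ta h₁.surjective
  obtain ⟨c, hc⟩ := Module.projective_lifting_property _ (tb ∘ₗ LinearMap.inr L P Q) h₂.surjective
  refine ⟨homOfLinear (M := summand P Q) a (LinearMap.coprod (S.X₂.incl ∘ₗ a) c)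
    (LinearMap.coprod_inl _ _), hom_ext (FGModuleCat.hom_ext ?_)⟩
  change S.g.hom.b.hom.hom ∘ₗ LinearMap.coprod (S.X₂.incl ∘ₗ a) c = tb
  refine LinearMap.prod_ext ?_ ?_
  · rw [LinearMap.comp_assoc, LinearMap.coprod_inl, ← LinearMap.comp_assoc, incl_comm,
      LinearMap.comp_assoc, ha, ht]
  · rw [LinearMap.comp_assoc, LinearMap.coprod_inr, hc]

variable {P Q}

/-- The morphism from `P ⟶ P × Q` to `M` given by maps `P ⟶ X` and `Q ⟶ Y`. -/
def summandDesc {M : mono L} (p : P →ₗ[L] M.obj.X) (q : Q →ₗ[L] M.obj.Y) : summand P Q ⟶ M :=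
  homOfLinear (M := summand P Q) p (LinearMap.coprod (M.incl ∘ₗ p) q) (LinearMap.coprod_inl _ _)

end Projectives

theorem exists_summand_deflation (M : mono L) :
    ∃ (m k : ℕ) (g : summand (L := L) (Fin m → L) (Fin k → L) ⟶ M),
      IsDeflation (monoConflations (FGModuleCat.{u} L)) g := by
  obtain ⟨m, p, hp⟩ := Module.Finite.exists_fin' L M.obj.X
  obtain ⟨k, q, hq⟩ := Module.Finite.exists_fin' L M.obj.Y
  exact ⟨m, k, summandDesc p q, isDeflation_of_surjective _ hp (coprod_surjective p hq)⟩

variable (L) in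
theorem hasEnoughProjectives : HasEnoughProjectives (monoConflations (FGModuleCat.{u} L)) := by
  intro M
  obtain ⟨m, k, g, hg⟩ := exists_summand_deflation M
  exact ⟨_, g, isProjectiveObj_summand _ _, hg⟩

/-! ### Syzygies and cosyzygies in the monomorphism category -/

/-- The class of the objects `(X, Y, f, 0)` such that `X` has finite projective dimension and
`Ext^i(-, L)` vanishes for `i > k` on `X` and on the cokernel `V` of `f`. Over an `n`-Gorenstein
ring and for `k = n` the first condition implies the second, and for `k = 0` these objects are
Gorenstein-projective. -/
def extBounded (k : ℕ) : ObjectProperty (mono L) := fun M =>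
  finiteProjDim L M ∧ ExtVanish L k M.obj.X L ∧
    ∃ (V : Type u) (_ : AddCommGroup V) (_ : Module L V) (g : M.obj.Y →ₗ[L] V),
      IsSES M.incl g ∧ ExtVanish L k V L

theorem extBounded_of_finiteProjDim {n : ℕ} (hn : injectiveDimension (ModuleCat.of.{u} L L) ≤ n)
    {M : mono L} (hM : finiteProjDim L M) : extBounded n M :=
  ⟨hM, extVanish_of_injectiveDimension_le hn, _, _, _, _, isSES_mkQ M.incl_injective,
    extVanish_of_injectiveDimension_le hn⟩

theorem extBounded.projective {M : mono L} (hM : extBounded 0 M) :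
    Module.Projective L M.obj.X := by
  obtain ⟨d, hd⟩ := projectiveDimension_lt_top_iff.1 hM.1
  exact projective_of_hasProjectiveDimensionLE d _ hd hM.2.1

theorem extBounded_summand (P Q : Type u) [AddCommGroup P] [Module L P] [Module.Finite L P]
    [AddCommGroup Q] [Module L Q] [Module.Finite L Q] [Module.Projective L P]
    [Module.Projective L Q] : extBounded 0 (summand (L := L) P Q) := by
  have hP : ExtVanish L 0 P L := extVanish_of_projective
  have hQ : IsSES (LinearMap.inl L P Q) (LinearMap.snd L P Q) :=
    ⟨LinearMap.inl_injective, Function.Exact.inl_snd, LinearMap.snd_surjective⟩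
  have : Module.Projective L (summand (L := L) P Q).obj.X :=
    inferInstanceAs (Module.Projective L P)
  exact ⟨finiteProjDim_of_projective _, hP, Q, _, _, _, hQ, extVanish_of_projective⟩

/-- Syzygies: if `f : X ⟶ Y` has cokernel `V`, then the kernel of a deflation `P ⟶ M` with `P`
projective is a monomorphism between syzygies of `X` and `Y` whose cokernel is a syzygy of `V`. -/
theorem exists_syzygy {k : ℕ} {M : mono L} (hM : extBounded k M) :
    ∃ (M' P : mono L) (ι : M' ⟶ P) (π : P ⟶ M) (h : ι ≫ π = 0),
      monoConflations (FGModuleCat.{u} L) (ShortComplex.mk ι π h) ∧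
        IsProjectiveObj (monoConflations (FGModuleCat.{u} L)) P ∧ extBounded 0 P ∧
        extBounded (k - 1) M' := by
  obtain ⟨hfin, hX, V, _, _, g, hg, hV⟩ := hM
  obtain ⟨m, p, hp⟩ := Module.Finite.exists_fin' L M.obj.X
  obtain ⟨l, q, hq⟩ := Module.Finite.exists_fin' L M.obj.Y
  let c : ((Fin m → L) × (Fin l → L)) →ₗ[L] M.obj.Y := LinearMap.coprod (M.incl ∘ₗ p) q
  have hp' := isSES_ker hp
  have hc := isSES_ker (coprod_surjective p hq)
  have hgq := isSES_ker (g := g ∘ₗ q) (hg.surjective.comp hq)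
  -- The kernel of `g ∘ q` is the cokernel of `ker p ⟶ ker c`.
  let i : LinearMap.ker p →ₗ[L] LinearMap.ker c :=
    (LinearMap.inl L (Fin m → L) (Fin l → L)).restrict fun x hx => by
      have : p x = 0 := hx
      simp [c, this]
  let r : LinearMap.ker c →ₗ[L] LinearMap.ker (g ∘ₗ q) :=
    (LinearMap.snd L (Fin m → L) (Fin l → L)).restrict fun x hx => by
      have hx : M.incl (p x.1) + q x.2 = 0 := hx
      have : g (M.incl (p x.1) + q x.2) = 0 := by rw [hx, map_zero]
      rw [map_add, hg.exact.apply_apply_eq_zero, zero_add] at this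
      exact this
  have hir : IsSES i r := by
    refine ⟨fun x y hxy => ?_, fun x => ⟨fun hx => ?_, ?_⟩, fun z => ?_⟩
    · exact Subtype.ext (congrArg (fun t => t.1.1) hxy)
    · obtain ⟨⟨x₁, x₂⟩, hx'⟩ := x
      obtain rfl : x₂ = 0 := congrArg Subtype.val hx
      refine ⟨⟨x₁, M.incl_injective ?_⟩, rfl⟩
      have : M.incl (p x₁) + q 0 = 0 := hx'
      simpa using this
    · rintro ⟨y, rfl⟩
      rfl
    · obtain ⟨y, hy⟩ := (hg.exact (q z.1)).1 z.2
      obtain ⟨x, rfl⟩ := hp y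
      refine ⟨⟨(-x, z.1), ?_⟩, rfl⟩
      change M.incl (p (-x)) + q z.1 = 0
      rw [map_neg, map_neg, hy, neg_add_cancel]
  let P : mono L := summand (Fin m → L) (Fin l → L)
  let M' : mono L := ofInjective i hir.injective
  let ι : M' ⟶ P := homOfLinear (M := M') (N := P) (LinearMap.ker p).subtype
    (LinearMap.ker c).subtype rfl
  refine ⟨M', P, ι, summandDesc p q, hom_ext (FGModuleCat.hom_ext hc.comp_eq_zero),
    conflation_of_isSES hp' hc, isProjectiveObj_summand _ _,
    extBounded_summand _ _, ?_, hp'.extVanish_left hX, _, _, _, r, hir, hgq.extVanish_left hV⟩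
  obtain ⟨d, hd⟩ := projectiveDimension_lt_top_iff.1 hfin
  have : Projective (ModuleCat.of L (Fin m → L)) :=
    (IsProjective.iff_projective (R := L) (Fin m → L)).1 inferInstance
  exact projectiveDimension_lt_top_iff.2 ⟨d, hp'.shortExact.hasProjectiveDimensionLT_X₁ (d + 1)
    (inferInstanceAs (HasProjectiveDimensionLT (ModuleCat.of L (Fin m → L)) (d + 1)))
    (hasProjectiveDimensionLT_of_ge (X := M.obj.X.obj) (d + 1) (d + 2) (by omega))⟩

/-- Cosyzygies: as `X` is projective and `V` has no extensions by `L`, the inclusion of `X` into `Y`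
splits, and an embedding of `V` into a free module `Q` gives an inflation from `X ⟶ Y` into
`X ⟶ X × Q`. -/
theorem exists_cosyzygy {R : Type w} [CommRing R] [IsNoetherianRing R] [Algebra R L]
    [Module.Finite R L] {n : ℕ} (hn : injectiveDimension (ModuleCat.of.{u} Lᵐᵒᵖ L) ≤ n)
    {M : mono L} (hM : extBounded 0 M) :
    ∃ (P M' : mono L) (ι : M ⟶ P) (π : P ⟶ M') (h : ι ≫ π = 0),
      monoConflations (FGModuleCat.{u} L) (ShortComplex.mk ι π h) ∧
        IsProjectiveObj (monoConflations (FGModuleCat.{u} L)) P ∧ extBounded 0 M' := by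
  have := hM.projective
  obtain ⟨-, hX, V, _, _, g, hg, hV⟩ := hM
  have : Module.Finite L V := Module.Finite.of_surjective g hg.surjective
  obtain ⟨r, hr⟩ := hg.exists_extension_of_projective hV (P := M.obj.X) LinearMap.id
  have hr' : ∀ x, r (M.incl x) = x := LinearMap.congr_fun hr
  obtain ⟨m, j, hj, hW⟩ := exists_embedding_of_extVanish (R := R) hn hV
  let W := (Fin m → L) ⧸ LinearMap.range j
  let P : mono L := summand M.obj.X (Fin m → L)
  let M' : mono L := ofInjective (0 : PUnit.{u + 1} →ₗ[L] W) fun _ _ _ => rfl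
  let b : M.obj.Y →ₗ[L] M.obj.X × (Fin m → L) := r.prod (j ∘ₗ g)
  let s : M.obj.X × (Fin m → L) →ₗ[L] W := (LinearMap.range j).mkQ ∘ₗ LinearMap.snd L _ _
  have hb : IsSES b s := by
    refine ⟨fun x y hxy => ?_, fun x => ⟨fun hx => ?_, ?_⟩, ?_⟩
    · have h₁ : r x = r y := congrArg Prod.fst hxy
      have h₂ : g x = g y := hj (congrArg Prod.snd hxy)
      obtain ⟨z, hz⟩ := (hg.exact (x - y)).1 (by rw [map_sub, h₂, sub_self])
      have : z = 0 := by rw [← hr' z, hz, map_sub, h₁, sub_self]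
      rw [this, map_zero] at hz
      exact (sub_eq_zero.1 hz.symm)
    · obtain ⟨x₁, x₂⟩ := x
      obtain ⟨v, rfl⟩ := (LinearMap.exact_map_mkQ_range j x₂).1 hx
      obtain ⟨y, rfl⟩ := hg.surjective v
      refine ⟨y + M.incl (x₁ - r y), Prod.ext ?_ ?_⟩
      · simp [b, hr']
      · simp [b, hg.exact.apply_apply_eq_zero]
    · rintro ⟨y, rfl⟩
      exact (LinearMap.exact_map_mkQ_range j (j (g y))).2 ⟨_, rfl⟩
    · exact (Submodule.mkQ_surjective _).comp LinearMap.snd_surjective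
  let ι : M ⟶ P := homOfLinear (N := P) LinearMap.id b <| LinearMap.ext fun x =>
    Prod.ext (hr' x) (by
      change j (g (M.incl x)) = 0
      rw [hg.exact.apply_apply_eq_zero, map_zero])
  let π : P ⟶ M' := homOfLinear (M := P) (N := M') 0 s <| LinearMap.ext fun x => by
    change (LinearMap.range j).mkQ 0 = 0
    exact map_zero _
  have : Module.Projective L M'.obj.X := inferInstanceAs (Module.Projective L PUnit.{u + 1})
  refine ⟨P, M', ι, π, hom_ext (FGModuleCat.hom_ext hb.comp_eq_zero), conflation_of_isSES ?_ hb,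
    isProjectiveObj_summand _ _, finiteProjDim_of_projective _, extVanish_of_projective,
    W, inferInstance, inferInstance, LinearMap.id,
    ⟨fun _ _ _ => rfl, fun x => ⟨fun hx => ⟨PUnit.unit, hx.symm⟩, ?_⟩, Function.surjective_id⟩, hW⟩
  · exact ⟨Function.injective_id, fun x => ⟨fun _ => ⟨x, rfl⟩, fun _ => rfl⟩, fun _ => ⟨0, rfl⟩⟩
  · rintro ⟨_, rfl⟩
    rfl

/-- Maps to projective objects extend along inflations with cokernel in `extBounded 0`. -/
theorem exists_extension {S : ShortComplex (mono L)}
    (hS : monoConflations (FGModuleCat.{u} L) S) (h₃ : extBounded 0 S.X₃) {T : mono L}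
    (hT : IsProjectiveObj (monoConflations (FGModuleCat.{u} L)) T) (t : S.X₁ ⟶ T) :
    ∃ b : S.X₂ ⟶ T, S.f ≫ b = t := by
  -- The target is a retract of an inclusion `P ⟶ P × Q` with `P` and `Q` free.
  obtain ⟨m, l, ε, K, κ, w, hε⟩ := exists_summand_deflation T
  obtain ⟨σ, hσ⟩ := hT _ hε (𝟙 T)
  suffices ∃ b : S.X₂ ⟶ summand (Fin m → L) (Fin l → L), S.f ≫ b = t ≫ σ by
    obtain ⟨b, hb⟩ := this
    refine ⟨b ≫ ε, ?_⟩
    rw [← Category.assoc, hb, Category.assoc]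
    exact (congrArg (t ≫ ·) hσ).trans (Category.comp_id t)
  generalize t ≫ σ = τ
  obtain ⟨ha, hb⟩ := isSES_of_conflation hS
  obtain ⟨-, hX, V, _, _, g, hg, hV⟩ := h₃
  have hY : ExtVanish L 0 S.X₃.obj.Y L := hg.extVanish_middle hX hV
  let τb : S.X₁.obj.Y →ₗ[L] (Fin m → L) × (Fin l → L) := τ.hom.b.hom.hom
  have hτ : ∀ x, (τb (S.X₁.incl x)).2 = 0 := fun x =>
    congrArg Prod.snd (LinearMap.congr_fun (incl_comm τ) x)
  obtain ⟨c₁, hc₁⟩ := hb.exists_extension_of_projective hY (LinearMap.fst L _ _ ∘ₗ τb)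
  obtain ⟨c₂, hc₂⟩ := hb.exists_extension_of_projective hY (LinearMap.snd L _ _ ∘ₗ τb)
  -- The second component has to be corrected so that it vanishes on the image of `S.X₂.obj.X`.
  obtain ⟨e, he⟩ := ha.exists_desc (c₂ ∘ₗ S.X₂.incl) <| by
    rw [LinearMap.comp_assoc, ← incl_comm S.f, ← LinearMap.comp_assoc, hc₂]
    exact LinearMap.ext hτ
  obtain ⟨e', he'⟩ := hg.exists_extension_of_projective hV e
  let c₃ := c₂ - e' ∘ₗ S.g.hom.b.hom.hom
  have hc₃ : c₃ ∘ₗ S.X₂.incl = 0 := by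
    rw [LinearMap.sub_comp, LinearMap.comp_assoc, incl_comm S.g, ← LinearMap.comp_assoc, he', he,
      sub_self]
  have hc₃' : c₃ ∘ₗ S.f.hom.b.hom.hom = LinearMap.snd L _ _ ∘ₗ τb := by
    rw [LinearMap.sub_comp, LinearMap.comp_assoc, hb.comp_eq_zero, LinearMap.comp_zero, sub_zero,
      hc₂]
  refine ⟨homOfLinear (N := summand (Fin m → L) (Fin l → L)) (c₁ ∘ₗ S.X₂.incl) (c₁.prod c₃) ?_,
    hom_ext (FGModuleCat.hom_ext ?_)⟩
  · exact LinearMap.ext fun x => Prod.ext rfl (LinearMap.congr_fun hc₃ x)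
  · exact LinearMap.ext fun x =>
      Prod.ext (LinearMap.congr_fun hc₁ x) (LinearMap.congr_fun hc₃' x)

theorem isGorensteinProjective_of_extBounded {R : Type w} [CommRing R] [IsNoetherianRing R]
    [Algebra R L] [Module.Finite R L] {n : ℕ}
    (hn : injectiveDimension (ModuleCat.of.{u} Lᵐᵒᵖ L) ≤ n) {M : mono L} (hM : extBounded 0 M) :
    IsGorensteinProjective (monoConflations (FGModuleCat.{u} L)) M := by
  refine isGorensteinProjective_of_class (fun _ => isExactPair) (extBounded 0)
    (fun W hW => exists_cosyzygy (R := R) hn hW) (fun W hW => ?_)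
    (fun S hS h₃ T hT t => exists_extension hS h₃ hT t) hM
  obtain ⟨M', P, ι, π, h, hS, hP, -, hM'⟩ := exists_syzygy hW
  exact ⟨M', P, ι, π, h, hS, hP, hM'⟩

end MonoCat

end ModuleMonos

/-! ### Finite resolutions -/

section Resolutions

variable {C : Type u} [Category.{v} C] [Preadditive C]

/-- Suppose that every object of the class `Q k` has a syzygy in `Q (k - 1)` with respect to a
Gorenstein-projective object, and that the objects of `Q 0` are Gorenstein-projective. Then the
objects of `Q n` have Gorenstein-projective resolutions of length `n`. -/
theorem hasGorensteinProjectiveResolution_of_syzygies {E : ObjectProperty (ShortComplex C)}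
    {B : ObjectProperty C} (Q : ℕ → ObjectProperty C) (hQB : ∀ k W, Q k W → B W)
    (hstep : ∀ k W, Q k W → ∃ (W' P : C) (ι : W' ⟶ P) (π : P ⟶ W) (h : ι ≫ π = 0),
      E (ShortComplex.mk ι π h) ∧ IsGorensteinProjective E P ∧ B P ∧ Q (k - 1) W')
    (h0 : ∀ W, Q 0 W → IsGorensteinProjective E W) {O : C} (hO : IsZero O) (hOB : B O)
    (hid : ∀ W : C, E (ShortComplex.mk (𝟙 W) (0 : W ⟶ O) comp_zero))
    (hid' : ∀ W : C, E (ShortComplex.mk (0 : O ⟶ W) (𝟙 W) zero_comp))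
    (n : ℕ) (X : B.FullSubcategory) (hX : Q n X.obj) :
    HasGorensteinProjectiveResolution E B n X := by
  -- The iterated syzygies `s j` of `X`, with `s j` in `Q (n - j)`.
  obtain ⟨s, hs₀, hs, hs'⟩ : ∃ s : ℕ → C, s 0 = X.obj ∧ (∀ j, Q (n - j) (s j)) ∧
      ∀ j, ∃ (P : C) (ι : s (j + 1) ⟶ P) (π : P ⟶ s j) (h : ι ≫ π = 0),
        E (ShortComplex.mk ι π h) ∧ IsGorensteinProjective E P ∧ B P := by
    choose next P ι π h hE hP hPB hnext using hstep
    let t : ∀ j, { W : C // Q (n - j) W } := fun j => Nat.rec ⟨X.obj, hX⟩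
      (fun j W => ⟨next (n - j) W.1 W.2, Nat.sub_sub n j 1 ▸ hnext (n - j) W.1 W.2⟩) j
    exact ⟨fun j => (t j).1, rfl, fun j => (t j).2, fun j => ⟨P (n - j) _ (t j).2,
      ι _ _ _, π _ _ _, h _ _ _, hE _ _ _, hP _ _ _, hPB _ _ _⟩⟩
  let O' : B.FullSubcategory := ⟨O, hOB⟩
  have hO' : IsZero O' := by
    rw [IsZero.iff_id_eq_zero]
    exact ObjectProperty.hom_ext _ (hO.eq_of_src _ _)
  let s' : ℕ → B.FullSubcategory := fun j => ⟨s j, hQB _ _ (hs j)⟩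
  let Z : ℤ → B.FullSubcategory := fun i =>
    if 0 < i then O' else if i < -(n : ℤ) then O' else s' (-i).toNat
  have hZpos : ∀ i : ℤ, 0 < i → Z i = O' := fun i hi => if_pos hi
  have hZneg : ∀ i : ℤ, i < -(n : ℤ) → Z i = O' := fun i hi => by
    simp only [Z]
    rw [if_neg (by omega), if_pos hi]
  have hZs : ∀ (i : ℤ) (j : ℕ), j ≤ n → i = -(j : ℤ) → Z i = s' j := fun i j hj hi => by
    subst hi
    simp only [Z]
    rw [if_neg (by omega), if_neg (by omega), neg_neg, Int.toNat_natCast]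
  -- A conflation from `V` to `W` whose middle term is as required in degree `i`.
  let conf : ℤ → B.FullSubcategory → B.FullSubcategory → Prop := fun i V W =>
    ∃ (K : B.FullSubcategory) (ι : V ⟶ K) (π : K ⟶ W) (h : ι ≫ π = 0),
      inducedConflations E B (ShortComplex.mk ι π h) ∧ (i = 0 → Nonempty (K ≅ X)) ∧
      (∀ j : ℕ, j ≤ n → i = -((j : ℤ) + 1) → IsGorensteinProjective E K.obj) ∧
      ((0 < i ∨ i < -((n : ℤ) + 1)) → IsZero K)
  have hconf : ∀ i, conf i (Z i) (Z (i + 1)) := by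
    intro i
    rcases lt_trichotomy i 0 with hi | rfl | hi
    · obtain ⟨j, rfl⟩ : ∃ j : ℕ, i = -((j : ℤ) + 1) := ⟨(-i - 1).toNat, by omega⟩
      rcases lt_trichotomy j n with hj | rfl | hj
      · rw [hZs _ (j + 1) hj (by push_cast; ring), hZs _ j hj.le (by ring)]
        obtain ⟨P, ι, π, h, hE, hP, hPB⟩ := hs' j
        refine ⟨⟨P, hPB⟩, ObjectProperty.homMk ι, ObjectProperty.homMk π,
          ObjectProperty.hom_ext _ h, hE, fun _ => by omega, fun _ _ _ => hP, fun _ => by omega⟩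
      · rw [hZneg _ (by omega), hZs _ j le_rfl (by ring)]
        refine ⟨s' j, 0, 𝟙 _, zero_comp, hid' _, fun _ => by omega, fun _ _ _ => h0 _ ?_,
          fun _ => by omega⟩
        simpa using hs j
      · rw [hZneg _ (by omega), hZneg _ (by omega)]
        exact ⟨O', 0, 𝟙 _, zero_comp, hid' _, fun _ => by omega, fun _ _ _ => by omega,
          fun _ => hO'⟩
    · rw [hZs 0 0 n.zero_le rfl, hZpos _ (by omega)]
      refine ⟨s' 0, 𝟙 _, 0, comp_zero, hid _, fun _ => ⟨?_⟩, fun _ _ _ => by omega,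
        fun _ => by omega⟩
      exact B.isoMk (eqToIso hs₀)
    · rw [hZpos _ hi, hZpos _ (by omega)]
      exact ⟨O', 𝟙 _, 0, comp_zero, hid _, fun _ => by omega, fun _ _ _ => by omega, fun _ => hO'⟩
  choose K ι π h hE hX hK hK' using hconf
  let K' : CochainComplex B.FullSubcategory ℤ :=
    CochainComplex.of K (fun i => π i ≫ ι (i + 1)) fun i => by
      rw [Category.assoc, reassoc_of% (h (i + 1)), zero_comp, comp_zero]
  exact ⟨K', ⟨Z, ι, π, h, hE, CochainComplex.of_d _ _⟩, hX 0 rfl, fun j hj => hK _ j hj rfl, hK'⟩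

end Resolutions

/-! ### The objects with a source of finite projective dimension -/

section FiniteProjectiveDimension

namespace MonoCat

section

variable {A : Type u} [Category.{v} A] [Abelian A] {O : MonoCat A}

theorem isZero_Y {M : MonoCat A} (h : IsZero M) : IsZero M.obj.Y := by
  rw [IsZero.iff_id_eq_zero]
  exact congrArg (fun u : M ⟶ M => u.hom.b) ((IsZero.iff_id_eq_zero _).1 h)

theorem conflation_id_zero (hO : IsZero O) (W : MonoCat A) :
    monoConflations A (ShortComplex.mk (𝟙 W) (0 : W ⟶ O) comp_zero) := by
  constructor
  · exact { exact := (ShortComplex.exact_iff_epi _ rfl).2 (inferInstanceAs (Epi (𝟙 W.obj.X)))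
            mono_f := inferInstanceAs (Mono (𝟙 W.obj.X))
            epi_g := ⟨fun _ _ _ => (isZero_X hO).eq_of_src _ _⟩ }
  · exact { exact := (ShortComplex.exact_iff_epi _ rfl).2 (inferInstanceAs (Epi (𝟙 W.obj.Y)))
            mono_f := inferInstanceAs (Mono (𝟙 W.obj.Y))
            epi_g := ⟨fun _ _ _ => (isZero_Y hO).eq_of_src _ _⟩ }

theorem conflation_zero_id (hO : IsZero O) (W : MonoCat A) :
    monoConflations A (ShortComplex.mk (0 : O ⟶ W) (𝟙 W) zero_comp) := by
  constructor
  · exact { exact := (ShortComplex.exact_iff_mono _ rfl).2 (inferInstanceAs (Mono (𝟙 W.obj.X)))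
            mono_f := ⟨fun _ _ _ => (isZero_X hO).eq_of_tgt _ _⟩
            epi_g := inferInstanceAs (Epi (𝟙 W.obj.X)) }
  · exact { exact := (ShortComplex.exact_iff_mono _ rfl).2 (inferInstanceAs (Mono (𝟙 W.obj.Y)))
            mono_f := ⟨fun _ _ _ => (isZero_Y hO).eq_of_tgt _ _⟩
            epi_g := inferInstanceAs (Epi (𝟙 W.obj.Y)) }

end

variable (L : Type u) [Ring L]

/-- The functor sending `(X, Y, f, 0)` to the module `X`. -/
abbrev source : mono L ⥤ ModuleCat.{u} L :=
  (isMono (FGModuleCat.{u} L)).ι ⋙ DMor.U₁ ⋙ forget₂ (FGModuleCat.{u} L) (ModuleCat.{u} L)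

theorem finiteProjDim_of_isZero {O : mono L} (hO : IsZero O) : finiteProjDim L O := by
  have : Subsingleton O.obj.X := ⟨fun x y => by
    have h := congrArg (fun t : O.obj.X ⟶ O.obj.X => t.hom.hom)
      ((IsZero.iff_id_eq_zero _).1 (isZero_X hO))
    exact (LinearMap.congr_fun h x).trans (LinearMap.congr_fun h y).symm⟩
  exact finiteProjDim_of_projective O

theorem isExactSubcategory_finiteProjDim [IsNoetherianRing L] :
    IsExactSubcategory (monoConflations (FGModuleCat.{u} L)) (finiteProjDim L) where
  closedUnderIso M N := by
    rintro ⟨e⟩ hM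
    exact (projectiveDimension_eq_of_iso ((source L).mapIso e)).symm.trans_lt hM
  closedUnderSummands M N := by
    rintro ⟨r⟩ hN
    exact (r.map (source L)).projectiveDimension_le.trans_lt hN
  zero_mem _ := finiteProjDim_of_isZero L
  extensionClosed S hS h₁ h₃ := by
    obtain ⟨d₁, h₁⟩ := projectiveDimension_lt_top_iff.1 h₁
    obtain ⟨d₃, h₃⟩ := projectiveDimension_lt_top_iff.1 h₃
    exact projectiveDimension_lt_top_iff.2 ⟨max d₁ d₃,
      (isSES_of_conflation hS).1.shortExact.hasProjectiveDimensionLT_X₂ (max d₁ d₃ + 1)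
        (hasProjectiveDimensionLT_of_ge (X := S.X₁.obj.X.obj) (d₁ + 1) _ (by omega))
        (hasProjectiveDimensionLT_of_ge (X := S.X₃.obj.X.obj) (d₃ + 1) _ (by omega))⟩

variable {L}

theorem hasGorensteinProjectiveResolution [IsNoetherianRing L] {R : Type w} [CommRing R]
    [IsNoetherianRing R] [Algebra R L] [Module.Finite R L] {n : ℕ} (hn : IsGorensteinRing n L)
    (X : (finiteProjDim L).FullSubcategory) :
    HasGorensteinProjectiveResolution (monoConflations (FGModuleCat.{u} L)) (finiteProjDim L)
      n X := by
  have hGP := fun (M : mono L) (hM : extBounded 0 M) =>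
    isGorensteinProjective_of_extBounded (R := R) hn.2 hM
  obtain ⟨O, hO⟩ := HasZeroObject.zero (C := mono L)
  refine hasGorensteinProjectiveResolution_of_syzygies extBounded (fun _ _ h => h.1)
    (fun k W hW => ?_) hGP hO (finiteProjDim_of_isZero L hO) (conflation_id_zero hO)
    (conflation_zero_id hO) n X (extBounded_of_finiteProjDim hn.1 X.property)
  obtain ⟨M', P, ι, π, h, hS, -, hP, hM'⟩ := exists_syzygy hW
  exact ⟨M', P, ι, π, h, hS, hGP P hP, hP.1, hM'⟩

end MonoCat

end FiniteProjectiveDimension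
end MonoGorenstein

theorem theorem5p5 {R : Type*} {Λ : Type*} [CommRing R] [Ring Λ] [Algebra R Λ]
    (hΛ : MonoGorenstein.IsArtinAlgebra R Λ) (n : ℕ) (hn : MonoGorenstein.IsGorensteinRing n Λ) :
    MonoGorenstein.IsGorensteinSubcategory
      (MonoGorenstein.monoConflations (FGModuleCat Λ)) (MonoGorenstein.finiteProjDim Λ) n := by
  obtain ⟨hR, hfin⟩ := hΛ
  have : IsNoetherianRing R := inferInstance
  have : IsNoetherianRing Λ :=
    isNoetherian_of_tower R (isNoetherian_of_isNoetherianRing_of_finite R Λ)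
  exact ⟨MonoGorenstein.MonoCat.isExactCategory _, MonoGorenstein.MonoCat.hasEnoughProjectives Λ,
    MonoGorenstein.MonoCat.isExactSubcategory_finiteProjDim Λ,
    MonoGorenstein.MonoCat.hasGorensteinProjectiveResolution (R := R) hn⟩
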